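/- Let $I=[0,1]$, let $\mathcal P_f(\mathbb N)$ be the set of finite subsets of $\mathbb N$, and let $\gamma=\{\gamma_\omega\}_{\omega\in\mathcal P_f(\mathbb N)}$ be a sequence of non-negative weights with $\gamma_\emptyset=1$ whose support $\omega_\gamma=\{\omega:\gamma_\omega>0\}$ is monotone: $\omega'\subset\omega\in\omega_\gamma$ implies $\omega'\in\omega_\gamma$. For $\sigma\subset\mathbb N$ let $P_\sigma f$ be the integral of $f:I^{\mathbb N}\to\mathbb R$ over the variables $x_k$, $k\in\sigma$, and, for a fixed anchor $x^\ast\in I$, let $P'_\sigma f$ be obtained from $f$ by setting $x_k=x^\ast$ for $k\in\sigma$. The ANOVA and anchored terms of $f$ are $$f_\omega=\sum_{\omega'\subset\omega}(-1)^{|\omega'|}P_{\omega'}P_{\omega^c}f,\qquad f'_\omega=\sum_{\omega'\subset\omega}(-1)^{|\omega'|}P'_{\omega'}P'_{\omega^c}f,$$ and, with $g^{(\omega)}$ the weak mixed first derivative with respect to all $x_k$, $k\in\omega$, the weighted norms are $$\|f\|_{\gamma,A}^2=\sum_{\omega\in\omega_\gamma}\gamma_\omega^{-1}\|f_\omega^{(\omega)}\|_{L_2(I^\omega)}^2,\qquad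 \|f\|_{\gamma,an}^2=\sum_{\omega\in\omega_\gamma}\gamma_\omega^{-1}\|{f'_\omega}^{(\omega)}\|_{L_2(I^\omega)}^2 .$$ Let $F_\gamma$ be the space of all finite sums $f(x)=\sum_\omega g_\omega(x_\omega)$ with $\omega\in\omega_\gamma$ and $g_\omega$ a continuous function on $I^\omega$ whose weak derivatives $\partial^S g_\omega=\prod_{k\in S}\partial_{x_k}g_\omega$, $S\subset\omega$, all exist in $L_2(I^\omega)$. (a) Put $q=\frac13-x^\ast(1-x^\ast)$ and suppose that there are numbers $\alpha_\omega>0$ ($\omega\in\omega_\gamma$) and constants $0<C',C''<\infty$ such that, for all $\omega\in\omega_\gamma$, $$\sum_{\hat\omega\in\omega_\gamma:\,\hat\omega\supset\omega}q^{|\hat\omega|}\alpha_{\hat\omega}\le C'q^{|\omega|}\alpha_\omega,\qquad(1)$$ $$\sum_{\omega'\in\omega_\gamma:\,\omega'\subset\omega}\frac{\alpha_{\omega'}}{\gamma_{\omega'}}\le C''\frac{\alpha_\omega}{\gamma_\omega}.\qquad(2)$$ Then, with $C=\sqrt{C'C''}$, both norms are finite on $F_\gamma$ and $$C^{-1}\|f\|_{\gamma,an}\le\|f\|_{\gamma,A}\le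 C\|f\|_{\gamma,an}\qquad(f\in F_\gamma).$$ Consequently the completions of $F_\gamma$ in the two norms coincide, with the same inequalities: a sequence in $F_\gamma$ is Cauchy for $\|\cdot\|_{\gamma,A}$ if and only if it is Cauchy for $\|\cdot\|_{\gamma,an}$, and the limits $a$ and $b$ of its $\|\cdot\|_{\gamma,A}$-norms and its $\|\cdot\|_{\gamma,an}$-norms then exist, are finite and satisfy $C^{-1}b\le a\le Cb$. (b) Suppose that, with constants $0<C',C''<\infty$, for all $\omega'\in\omega_\gamma$, $$\sum_{\omega''\in\omega_\gamma:\,\omega''\supset\omega'}2^{-|\omega''|}\sqrt{\gamma_{\omega''}}\le C'2^{-|\omega'|}\sqrt{\gamma_{\omega'}},\qquad\sum_{\omega\in\omega_\gamma:\,\omega\subset\omega'}\frac1{\sqrt{\gamma_\omega}}\le\frac{C''}{\sqrt{\gamma_{\omega'}}}$$ (the sufficient condition for the norm equivalence given by Hefter, Ritter and Wasilkowski and by Hinrichs and Schneider for the anchor $x^\ast=0$). Then for every $\tilde q\in[1,\frac32]$ the sequence $\alpha_\omega=\tilde q^{|\omega|}\sqrt{\gamma_\omega}$ satisfies (1) and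 (2) with $q=\frac13$, the value belonging to $x^\ast=0$, and with the same constants $C',C''$. -/

import Mathlib

open MeasureTheory Filter Topology
open scoped ENNReal

namespace AnovaAnchored

noncomputable section

/-! ## Weights -/

/-- The support `ω_γ = {ω : γ_ω > 0}` of a weight sequence indexed by the finite subsets of `ℕ`. -/
def weightSupport (γ : Finset ℕ → ℝ) : Set (Finset ℕ) := {ω | 0 < γ ω}

/-- Non-negative weight sequences with `γ_∅ = 1` and monotone (subset-closed) support. -/
structure IsMonotoneWeight (γ : Finset ℕ → ℝ) : Prop where
  nonneg : ∀ ω, 0 ≤ γ ω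
  empty : γ ∅ = 1
  monotone : ∀ ω ∈ weightSupport γ, ∀ ω' ⊆ ω, ω' ∈ weightSupport γ

/-- The constant `q = 1/3 - x* (1 - x*)` belonging to the anchor `x*`. -/
def anchorConst (xs : unitInterval) : ℝ := 1 / 3 - (xs : ℝ) * (1 - (xs : ℝ))

/-- The superset summation condition: for every `ω ∈ ω_γ`, the sum over all `η ∈ ω_γ`, `η ⊇ ω`,
of `q^|η| α_η` converges and is at most `C' q^|ω| α_ω`. -/
def SupersetCond (γ α : Finset ℕ → ℝ) (q C' : ℝ) : Prop :=
  ∀ ω ∈ weightSupport γ,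
    Summable (fun η : {η : Finset ℕ // η ∈ weightSupport γ ∧ ω ⊆ η} => q ^ η.1.card * α η.1) ∧
    ∑' η : {η : Finset ℕ // η ∈ weightSupport γ ∧ ω ⊆ η}, q ^ η.1.card * α η.1
      ≤ C' * (q ^ ω.card * α ω)

/-- The subset summation condition: for every `ω ∈ ω_γ`, the sum over all `ω' ∈ ω_γ`, `ω' ⊆ ω`,
of `α_ω' / γ_ω'` is at most `C'' α_ω / γ_ω`. -/
def SubsetCond (γ α : Finset ℕ → ℝ) (C'' : ℝ) : Prop :=
  ∀ ω ∈ weightSupport γ,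
    ∑ ω' ∈ ω.powerset with 0 < γ ω', α ω' / γ ω' ≤ C'' * (α ω / γ ω)

/-- The two earlier conditions for the anchor `0`: for all `ω' ∈ ω_γ`, the sum over `η ⊇ ω'` of
`2^(-|η|) √γ_η` is at most `C' 2^(-|ω'|) √γ_ω'`, and the sum over `ω ⊆ ω'` of `1 / √γ_ω` is at most
`C'' / √γ_ω'` (all index sets being taken in `ω_γ`). -/
def EarlierCond (γ : Finset ℕ → ℝ) (C' C'' : ℝ) : Prop :=
  ∀ ω' ∈ weightSupport γ,
    (Summable (fun η : {η : Finset ℕ // η ∈ weightSupport γ ∧ ω' ⊆ η} =>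
        ((2 : ℝ) ^ η.1.card)⁻¹ * √(γ η.1)) ∧
      ∑' η : {η : Finset ℕ // η ∈ weightSupport γ ∧ ω' ⊆ η}, ((2 : ℝ) ^ η.1.card)⁻¹ * √(γ η.1)
        ≤ C' * (((2 : ℝ) ^ ω'.card)⁻¹ * √(γ ω'))) ∧
    ∑ ω ∈ ω'.powerset with 0 < γ ω, 1 / √(γ ω) ≤ C'' / √(γ ω')

/-! ## Mixed weak derivatives and the Sobolev space of mixed smoothness one on a cube -/

section Cube

variable {ι : Type} [Fintype ι]

/-- The mixed partial derivative `∏_{k ∈ S} ∂/∂x_k` of a smooth function on `ℝ^ι` (the order of the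
differentiations is immaterial for smooth functions). -/
def mixedPartial (S : Finset ι) (φ : (ι → ℝ) → ℝ) : (ι → ℝ) → ℝ := by
  classical
  exact S.toList.foldr (fun k ψ x => lineDeriv ℝ ψ x (Pi.single k 1)) φ

/-- Test functions: smooth functions with compact support in the open unit cube `(0,1)^ι`. -/
structure IsTestFunction (φ : (ι → ℝ) → ℝ) : Prop where
  smooth : ContDiff ℝ (⊤ : ℕ∞) φ
  compact : HasCompactSupport φ
  support : tsupport φ ⊆ {x | ∀ k, x k ∈ Set.Ioo (0 : ℝ) 1}

/-- `v ∈ L₂([0,1]^ι)` is the weak mixed derivative `∂^S g`, `∂^S = ∏_{k ∈ S} ∂/∂x_k`, of `g`. -/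
def IsWeakMixedDeriv (S : Finset ι) (g v : (ι → unitInterval) → ℝ) : Prop :=
  MemLp v 2 volume ∧
  ∀ φ : (ι → ℝ) → ℝ, IsTestFunction φ →
    ∫ x : ι → unitInterval, g x * mixedPartial S φ (fun k => (x k : ℝ))
      = (-1) ^ S.card * ∫ x : ι → unitInterval, v x * φ (fun k => (x k : ℝ))

/-- The Sobolev space of dominating mixed smoothness one on `[0,1]^ι`, i.e. the Hilbert space tensor
product of copies of `H¹([0,1])`, as a space of continuous functions (every element has a unique
continuous representative): all weak derivatives `∂^S g` exist and are in `L₂`. -/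
structure IsMixedH1 (g : (ι → unitInterval) → ℝ) : Prop where
  continuous : Continuous g
  deriv : ∀ S : Finset ι, ∃ v, IsWeakMixedDeriv S g v

/-- The `L₂`-norm of the mixed first derivative of `g` with respect to all its variables. The weak
derivative is unique almost everywhere; the value is `∞` if there is none. -/
def mixedDerivNorm (g : (ι → unitInterval) → ℝ) : ℝ≥0∞ :=
  ⨅ (v : (ι → unitInterval) → ℝ) (_ : IsWeakMixedDeriv Finset.univ g v), eLpNorm v 2 volume

end Cube

/-! ## Functions of infinitely many variables -/

/-- The finite sums `f(x) = ∑_ω g_ω(x_ω)`, with `ω ∈ ω_γ` and `g_ω` of mixed `H¹`-smoothness on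
`[0,1]^ω`. -/
def finiteSums (γ : Finset ℕ → ℝ) : Set ((ℕ → unitInterval) → ℝ) :=
  {f | ∃ (T : Finset (Finset ℕ)) (g : ∀ ω : Finset ℕ, (ω → unitInterval) → ℝ),
    (∀ ω ∈ T, ω ∈ weightSupport γ ∧ IsMixedH1 (g ω)) ∧
    ∀ x : ℕ → unitInterval, f x = ∑ ω ∈ T, g ω (fun k => x k)}

/-- The uniform probability measure on `[0,1]^∞`. -/
def cubeMeasure : Measure (ℕ → unitInterval) :=
  Measure.infinitePi (fun _ => (volume : Measure unitInterval))

/-- The projector `P_σ`: integration over the variables with indices in `σ`. -/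
def avg (σ : Set ℕ) (f : (ℕ → unitInterval) → ℝ) :
    (ℕ → unitInterval) → ℝ := by
  classical
  exact fun x => ∫ t, f (σ.piecewise t x) ∂cubeMeasure

/-- The projector `P'_σ`: the variables with indices in `σ` are set to the anchor `x*`. -/
def anchorAt (xs : unitInterval) (σ : Set ℕ) (f : (ℕ → unitInterval) → ℝ) :
    (ℕ → unitInterval) → ℝ := by
  classical
  exact fun x => f (σ.piecewise (fun _ => xs) x)

/-- For a family of projectors `Q_σ = ∏_{k ∈ σ} Q_k`, the term
`(Id - Q)_ω Q_{ω^c} f = ∑_{ω' ⊆ ω} (-1)^|ω'| Q_{ω'} Q_{ω^c} f`. -/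
def decompTerm (Q : Set ℕ → ((ℕ → unitInterval) → ℝ) → (ℕ → unitInterval) → ℝ) (ω : Finset ℕ)
    (f : (ℕ → unitInterval) → ℝ) : (ℕ → unitInterval) → ℝ :=
  fun x => ∑ ω' ∈ ω.powerset, (-1) ^ ω'.card * Q ω' (Q (ω : Set ℕ)ᶜ f) x

/-- A function depending only on the variables in `ω`, as a function on `[0,1]^ω`. -/
def toCube (ω : Finset ℕ) (F : (ℕ → unitInterval) → ℝ) : (ω → unitInterval) → ℝ :=
  fun y => F (fun k => if h : k ∈ ω then y ⟨k, h⟩ else 0)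

/-- The weighted norm `(∑_{ω ∈ ω_γ} γ_ω⁻¹ ‖∂^ω f_ω‖²)^(1/2)` for the decomposition `f = ∑_ω f_ω`
generated by the projectors `Q`. -/
def decompNorm (Q : Set ℕ → ((ℕ → unitInterval) → ℝ) → (ℕ → unitInterval) → ℝ) (γ : Finset ℕ → ℝ)
    (f : (ℕ → unitInterval) → ℝ) : ℝ≥0∞ :=
  (∑' ω : weightSupport γ,
    ENNReal.ofReal (γ ω.1)⁻¹ * mixedDerivNorm (toCube ω.1 (decompTerm Q ω.1 f)) ^ 2) ^ (1 / 2 : ℝ)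

/-- The weighted ANOVA norm. -/
def anovaNorm (γ : Finset ℕ → ℝ) (f : (ℕ → unitInterval) → ℝ) : ℝ≥0∞ := decompNorm avg γ f

/-- The weighted anchored norm with anchor `x*`. -/
def anchoredNorm (xs : unitInterval) (γ : Finset ℕ → ℝ) (f : (ℕ → unitInterval) → ℝ) : ℝ≥0∞ :=
  decompNorm (anchorAt xs) γ f

/-- Cauchy sequences with respect to a norm; the elements of the completion of `finiteSums γ` are
the classes of its Cauchy sequences, their norm being the limit of the norms. -/
def IsCauchyFor (N : ((ℕ → unitInterval) → ℝ) → ℝ≥0∞) (u : ℕ → (ℕ → unitInterval) → ℝ) : Prop :=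
  ∀ ε : ℝ≥0∞, 0 < ε → ∃ n₀ : ℕ, ∀ m ≥ n₀, ∀ n ≥ n₀, N (u m - u n) < ε

end

end AnovaAnchored

/-! Everything rests on one identity in one variable. If `h` has the square integrable weak
derivative `h'` on `[0,1]`, then `∫ h - h a = ∫ h' t * kern a t`, with `kern a t = -t` for `t ≤ a`
and `1 - t` beyond, and `∫ (kern a) ^ 2 = 1/3 - a (1 - a) = q`. Hence `∫ h = ∫ h' * kern a` when `h
a = 0`, and `h a = -∫ h' * kern a` when `∫ h = 0`: up to sign, the two projectors play symmetric
roles.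

Let `F` depend on the variables in `η` and be annihilated by one kind of projector in each of them.
Its other-kind term with index `ω ⊆ η` has, as mixed derivative in `ω`, that of the projection of
`F` along `η \ ω`, since each remaining summand of the alternating sum is free of some variable in
`ω`. Applying the identity in every variable of `η \ ω` writes this derivative as the integral of
`∂^η F` against a product of kernels, up to sign. Cauchy-Schwarz gives the factor `√q ^ |η \ ω|`;
this is `TermBound`, proved in both directions by `termBound_avg_anchorAt` and
`termBound_anchorAt_avg`.

A finite sum is the sum of its terms of one kind, and such a term with index `η` contributes to the
other-kind term `ω` only if `ω ⊆ η`. So the derivative norms satisfy `a_ω ≤ ∑_{η ⊇ ω} √q ^ |η \ ω|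
b_η`. Cauchy-Schwarz with weights `α_η`, condition (1), an interchange of sums and condition (2)
give `∑ a_ω² / γ_ω ≤ C' C'' ∑ b_η² / γ_η` (`sum_inv_mul_sq_le`). Minkowski's inequality then carries
the bounds to limits along Cauchy sequences.

To keep the derivatives weak, functions stay on the infinite cube and are tested against functions
of finitely many variables (`HasCylWeakDeriv`). A variable is removed by testing with products `φ *
ψ(x_j)` and applying the one-variable facts to slice integrals. -/

namespace AnovaAnchored

/-! ## Weak derivatives on the unit interval -/

/-- Smooth functions on the line with support in the open unit interval. -/
structure IsIntervalTest (ψ : ℝ → ℝ) : Prop where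
  smooth : ContDiff ℝ (⊤ : ℕ∞) ψ
  support : tsupport ψ ⊆ Set.Ioo 0 1

theorem IsIntervalTest.eq_zero {ψ : ℝ → ℝ} (h : IsIntervalTest ψ) {x : ℝ}
    (hx : x ∉ Set.Ioo (0 : ℝ) 1) : ψ x = 0 :=
  image_eq_zero_of_notMem_tsupport fun h' => hx (h.support h')

theorem IsIntervalTest.deriv {ψ : ℝ → ℝ} (h : IsIntervalTest ψ) : IsIntervalTest (deriv ψ) where
  smooth := by
    have := h.smooth
    rw [contDiff_infty_iff_deriv] at this
    exact this.2
  support := tsupport_deriv_subset.trans h.support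

theorem IsIntervalTest.isCompact {ψ : ℝ → ℝ} (h : IsIntervalTest ψ) : IsCompact (tsupport ψ) :=
  isCompact_Icc.of_isClosed_subset (isClosed_tsupport ψ)
    (h.support.trans Set.Ioo_subset_Icc_self)

/-- Integration by parts for an absolutely continuous primitive, whose derivative is `W` only almost
everywhere. -/
theorem integral_primitive_mul_deriv {W g : ℝ → ℝ} (hW : IntervalIntegrable W volume 0 1)
    (hg : ContDiff ℝ 1 g) :
    ∫ x in (0 : ℝ)..1, (∫ t in (0 : ℝ)..x, W t) * deriv g x
      = (∫ t in (0 : ℝ)..1, W t) * g 1 - ∫ x in (0 : ℝ)..1, W x * g x := by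
  have h1 := hW.absolutelyContinuousOnInterval_intervalIntegral (c := 0) (by simp)
  rw [h1.integral_mul_deriv_eq_deriv_mul hg.contDiffOn.absolutelyContinuousOnInterval]
  simp only [intervalIntegral.integral_same, zero_mul, sub_zero]
  congr 1
  refine intervalIntegral.integral_congr_ae ?_
  filter_upwards [hW.ae_hasDerivAt_integral] with x hx hx'
  rw [(hx (Set.uIoc_subset_uIcc hx') 0 (by simp)).deriv]

/-- The primitive from `0` vanishes to the left of the support of `η`, and the zero mean makes it
vanish again to the right, so its support stays in a compact subinterval of `(0,1)`. -/
theorem IsIntervalTest.exists_primitive {η : ℝ → ℝ} (h : IsIntervalTest η)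
    (h0 : ∫ x in (0 : ℝ)..1, η x = 0) : ∃ ψ, IsIntervalTest ψ ∧ _root_.deriv ψ = η := by
  obtain ⟨a, b, ha, hb, hab⟩ : ∃ a b : ℝ, 0 < a ∧ b < 1 ∧ tsupport η ⊆ Set.Icc a b := by
    rcases (tsupport η).eq_empty_or_nonempty with he | hne
    · exact ⟨1 / 2, 1 / 2, by norm_num, by norm_num, by simp [he]⟩
    · obtain ⟨a, ha⟩ := h.isCompact.exists_isLeast hne
      obtain ⟨b, hb⟩ := h.isCompact.exists_isGreatest hne
      exact ⟨a, b, (h.support ha.1).1, (h.support hb.1).2, fun x hx => ⟨ha.2 hx, hb.2 hx⟩⟩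
  have hz : ∀ x ∉ Set.Icc a b, η x = 0 := fun x hx =>
    image_eq_zero_of_notMem_tsupport fun h' => hx (hab h')
  have hc : Continuous η := h.smooth.continuous
  have hd : ∀ x, HasDerivAt (fun x => ∫ t in (0 : ℝ)..x, η t) (η x) x := fun x =>
    hc.integral_hasStrictDerivAt 0 x |>.hasDerivAt
  have hd' : _root_.deriv (fun x => ∫ t in (0 : ℝ)..x, η t) = η := funext fun x => (hd x).deriv
  refine ⟨fun x => ∫ t in (0 : ℝ)..x, η t, ⟨?_, ?_⟩, hd'⟩
  · rw [contDiff_infty_iff_deriv, hd']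
    exact ⟨fun x => (hd x).differentiableAt, h.smooth⟩
  · refine (closure_minimal ?_ isClosed_Icc).trans (Set.Icc_subset_Ioo ha hb)
    intro x hx
    by_contra hx'
    apply hx
    rw [Set.mem_Icc, not_and_or, not_le, not_le] at hx'
    rcases hx' with hx' | hx'
    · refine intervalIntegral.integral_zero_ae (Eventually.of_forall fun t ht => hz t ?_)
      rintro ⟨h1, -⟩
      rw [Set.uIoc, Set.mem_Ioc] at ht
      have := max_lt ha hx'
      linarith [ht.2]
    · have h1 : ∫ t in (1 : ℝ)..x, η t = 0 := by
        refine intervalIntegral.integral_zero_ae (Eventually.of_forall fun t ht => hz t ?_)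
        rintro ⟨-, h1⟩
        rw [Set.uIoc, Set.mem_Ioc] at ht
        have := lt_min hb hx'
        linarith [ht.1]
      have := intervalIntegral.integral_add_adjacent_intervals
        (hc.intervalIntegrable (μ := volume) 0 1) (hc.intervalIntegrable (μ := volume) 1 x)
      rw [h0, h1] at this
      simpa using this.symm

theorem exists_isIntervalTest_integral_eq_one :
    ∃ χ, IsIntervalTest χ ∧ ∫ x in (0 : ℝ)..1, χ x = 1 := by
  let f : ContDiffBump (1 / 2 : ℝ) := ⟨1 / 8, 1 / 4, by norm_num, by norm_num⟩
  refine ⟨f.normed volume, ⟨f.contDiff_normed, ?_⟩, ?_⟩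
  · rw [f.tsupport_normed_eq]
    intro x hx
    rw [Metric.mem_closedBall, Real.dist_eq, abs_le] at hx
    have h4 : f.rOut = 1 / 4 := rfl
    rw [h4] at hx
    constructor <;> linarith [hx.1, hx.2]
  · rw [intervalIntegral.integral_eq_integral_of_support_subset, f.integral_normed]
    rw [f.support_normed_eq]
    intro x hx
    rw [Metric.mem_ball, Real.dist_eq, abs_lt] at hx
    have h4 : f.rOut = 1 / 4 := rfl
    rw [h4] at hx
    constructor <;> linarith [hx.1, hx.2]

theorem ae_eq_zero_of_integral_mul_intervalTest {G : ℝ → ℝ} (hG : IntervalIntegrable G volume 0 1)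
    (h : ∀ ψ, IsIntervalTest ψ → ∫ x in (0 : ℝ)..1, G x * ψ x = 0) :
    ∀ᵐ x, x ∈ Set.Ioo (0 : ℝ) 1 → G x = 0 := by
  refine isOpen_Ioo.ae_eq_zero_of_integral_contDiff_smul_eq_zero
    (IntegrableOn.locallyIntegrableOn ?_) fun g hg _ hgs => ?_
  · rw [intervalIntegrable_iff_integrableOn_Ioo_of_le zero_le_one] at hG
    exact hG
  · have ht : IsIntervalTest g := ⟨hg, hgs⟩
    rw [← h g ht, intervalIntegral.integral_eq_integral_of_support_subset]
    · simp [mul_comm]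
    · intro x hx
      by_contra hx'
      exact hx (by simp [ht.eq_zero (fun h => hx' (Set.Ioo_subset_Ioc_self h))])

/-- The du Bois-Reymond lemma: derivatives of test functions are exactly the test functions of mean
zero, and any test function becomes one after subtracting a multiple of a fixed `χ` of integral one.
-/
theorem eq_of_integral_mul_deriv_eq_zero {G : ℝ → ℝ} (hG : ContinuousOn G (Set.Icc 0 1))
    (h : ∀ ψ, IsIntervalTest ψ → ∫ x in (0 : ℝ)..1, G x * deriv ψ x = 0) :
    ∃ c, ∀ x ∈ Set.Icc (0 : ℝ) 1, G x = c := by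
  obtain ⟨χ, hχ, hχ1⟩ := exists_isIntervalTest_integral_eq_one
  have hGi : IntervalIntegrable G volume 0 1 :=
    ContinuousOn.intervalIntegrable (by rwa [Set.uIcc_of_le zero_le_one])
  have hGm : ∀ ψ : ℝ → ℝ, Continuous ψ → IntervalIntegrable (fun x => G x * ψ x) volume 0 1 :=
    fun ψ hψ => hGi.mul_continuousOn hψ.continuousOn
  refine ⟨∫ x in (0 : ℝ)..1, G x * χ x, ?_⟩
  set c := ∫ x in (0 : ℝ)..1, G x * χ x with hc
  have key : ∀ᵐ x, x ∈ Set.Ioo (0 : ℝ) 1 → G x - c = 0 := by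
    refine ae_eq_zero_of_integral_mul_intervalTest (hGi.sub (by simp)) fun η hη => ?_
    have hηc := hη.smooth.continuous
    have hχc := hχ.smooth.continuous
    set m := ∫ x in (0 : ℝ)..1, η x with hm
    have hη' : IsIntervalTest (fun x => η x - m * χ x) := by
      refine ⟨hη.smooth.sub (contDiff_const.mul hχ.smooth), ?_⟩
      refine (tsupport_sub (f := η) (g := fun x => m * χ x)).trans
        (Set.union_subset hη.support ?_)
      exact (tsupport_mul_subset_right).trans hχ.support
    obtain ⟨ψ, hψ, hψd⟩ := hη'.exists_primitive (by
      rw [intervalIntegral.integral_sub (hηc.intervalIntegrable _ _)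
        ((hχc.intervalIntegrable _ _).const_mul m), intervalIntegral.integral_const_mul,
        hχ1]
      simp [hm])
    have h0 := h ψ hψ
    rw [hψd] at h0
    simp_rw [mul_sub, mul_left_comm _ m] at h0
    rw [intervalIntegral.integral_sub (hGm _ hηc) ((hGm _ hχc).const_mul m),
      intervalIntegral.integral_const_mul] at h0
    simp_rw [sub_mul]
    rw [intervalIntegral.integral_sub (hGm _ hηc) ((hηc.intervalIntegrable _ _).const_mul c),
      intervalIntegral.integral_const_mul]
    linarith [mul_comm m c]
  have hopen : Set.EqOn G (fun _ => c) (Set.Ioo 0 1) := by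
    refine Measure.eqOn_open_of_ae_eq (μ := volume) ?_ isOpen_Ioo
      (hG.mono Set.Ioo_subset_Icc_self) continuousOn_const
    rw [EventuallyEq, ae_restrict_iff' measurableSet_Ioo]
    filter_upwards [key] with x hx hx'
    linarith [hx hx']
  refine hopen.of_subset_closure hG continuousOn_const Set.Ioo_subset_Icc_self ?_
  rw [closure_Ioo zero_ne_one]

theorem intervalIntegral_congr {f g : ℝ → ℝ} {a b : ℝ} (h : Set.EqOn f g (Set.uIoc a b)) :
    ∫ x in a..b, f x = ∫ x in a..b, g x :=
  intervalIntegral.integral_congr_ae (Eventually.of_forall fun _ hx => h hx)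

/-- The representer of `g ↦ ∫ g - g a` in terms of the derivative of `g`. -/
noncomputable def kern (a t : ℝ) : ℝ := if t ≤ a then -t else 1 - t

/-- By du Bois-Reymond, `H` is a constant plus the primitive of `W`. Integrating the primitive by
parts gives `∫ W t * (1 - t)`, its value at `a` is the integral of `W` over `[0,a]`, and the
difference is the integral against `kern a`. -/
theorem integral_sub_eval_of_weakDeriv {H W : ℝ → ℝ} (hH : ContinuousOn H (Set.Icc 0 1))
    (hW : IntervalIntegrable W volume 0 1)
    (h : ∀ ψ, IsIntervalTest ψ →
      ∫ x in (0 : ℝ)..1, H x * deriv ψ x = -∫ x in (0 : ℝ)..1, W x * ψ x)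
    {a : ℝ} (ha : a ∈ Set.Icc (0 : ℝ) 1) :
    (∫ x in (0 : ℝ)..1, H x) - H a = ∫ x in (0 : ℝ)..1, W x * kern a x := by
  have hw : ContinuousOn (fun x => ∫ t in (0 : ℝ)..x, W t) (Set.Icc 0 1) := by
    have := intervalIntegral.continuousOn_primitive_interval (μ := volume) (f := W) (a := 0)
      (b := 1) (by
        rw [Set.uIcc_of_le zero_le_one]
        exact (intervalIntegrable_iff_integrableOn_Icc_of_le zero_le_one).1 hW)
    rwa [Set.uIcc_of_le zero_le_one] at this
  have hHi : IntervalIntegrable H volume 0 1 :=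
    ContinuousOn.intervalIntegrable (by rwa [Set.uIcc_of_le zero_le_one])
  have hwi : IntervalIntegrable (fun x => ∫ t in (0 : ℝ)..x, W t) volume 0 1 :=
    ContinuousOn.intervalIntegrable (by rwa [Set.uIcc_of_le zero_le_one])
  obtain ⟨c, hc⟩ := eq_of_integral_mul_deriv_eq_zero (hH.sub hw) fun ψ hψ => by
    have hψc := hψ.deriv.smooth.continuous.continuousOn (s := Set.uIcc (0 : ℝ) 1)
    simp_rw [Pi.sub_apply, sub_mul]
    rw [intervalIntegral.integral_sub (hHi.mul_continuousOn hψc) (hwi.mul_continuousOn hψc), h ψ hψ,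
      integral_primitive_mul_deriv hW (hψ.smooth.of_le (by simp)), hψ.eq_zero (by simp)]
    simp
  have hHx : ∀ x ∈ Set.Icc (0 : ℝ) 1, H x = c + ∫ t in (0 : ℝ)..x, W t := fun x hx => by
    have := hc x hx
    simp only [Pi.sub_apply] at this
    linarith
  have h1 : ∫ x in (0 : ℝ)..1, H x = ∫ x in (0 : ℝ)..1, (c + ∫ t in (0 : ℝ)..x, W t) := by
    refine intervalIntegral.integral_congr fun x hx => hHx x ?_
    rwa [Set.uIcc_of_le zero_le_one] at hx
  -- Integration by parts against `g x = x` computes the mean of the primitive.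
  have h2 := integral_primitive_mul_deriv hW (g := fun x => x) contDiff_id
  simp only [deriv_id'', mul_one] at h2
  have hWx : IntervalIntegrable (fun x => W x * x) volume 0 1 :=
    hW.mul_continuousOn continuous_id.continuousOn
  have hW0 : IntervalIntegrable W volume 0 a := hW.mono_set (by
    rw [Set.uIcc_of_le zero_le_one, Set.uIcc_of_le ha.1]; exact Set.Icc_subset_Icc_right ha.2)
  have hW1 : IntervalIntegrable W volume a 1 := hW.mono_set (by
    rw [Set.uIcc_of_le zero_le_one, Set.uIcc_of_le ha.2]; exact Set.Icc_subset_Icc_left ha.1)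
  have hX0 : IntervalIntegrable (fun x => W x * x) volume 0 a :=
    hW0.mul_continuousOn continuous_id.continuousOn
  have hX1 : IntervalIntegrable (fun x => W x * x) volume a 1 :=
    hW1.mul_continuousOn continuous_id.continuousOn
  have e0 : Set.EqOn (fun x => -(W x * x)) (fun x => W x * kern a x) (Set.uIoc 0 a) := by
    intro x hx
    rw [Set.uIoc_of_le ha.1] at hx
    simp [kern, hx.2]
  have e1 : Set.EqOn (fun x => W x - W x * x) (fun x => W x * kern a x) (Set.uIoc a 1) := by
    intro x hx
    rw [Set.uIoc_of_le ha.2] at hx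
    simp only [kern, not_le.2 hx.1, if_false]
    ring
  have h3 : ∫ x in (0 : ℝ)..a, W x * kern a x = -∫ x in (0 : ℝ)..a, W x * x := by
    rw [← intervalIntegral.integral_neg]
    exact (intervalIntegral_congr e0).symm
  have h4 : ∫ x in a..1, W x * kern a x = (∫ x in a..1, W x) - ∫ x in a..1, W x * x := by
    rw [← intervalIntegral.integral_sub hW1 hX1]
    exact (intervalIntegral_congr e1).symm
  have hK0 : IntervalIntegrable (fun x => W x * kern a x) volume 0 a := hX0.neg.congr e0
  have hK1 : IntervalIntegrable (fun x => W x * kern a x) volume a 1 := (hW1.sub hX1).congr e1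
  rw [h1, hHx a ha, intervalIntegral.integral_add (by simp) hwi, h2,
    ← intervalIntegral.integral_add_adjacent_intervals hK0 hK1, h3, h4,
    ← intervalIntegral.integral_add_adjacent_intervals hX0 hX1,
    ← intervalIntegral.integral_add_adjacent_intervals hW0 hW1]
  simp only [intervalIntegral.integral_const, sub_zero, one_smul]
  ring

/-- The source of `q`: the integral equals `(a ^ 3 + (1 - a) ^ 3) / 3`. -/
theorem integral_kern_sq {a : ℝ} (ha : a ∈ Set.Icc (0 : ℝ) 1) :
    ∫ x in (0 : ℝ)..1, kern a x ^ 2 = 1 / 3 - a * (1 - a) := by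
  have e0 : Set.EqOn (fun x => x ^ 2) (fun x => kern a x ^ 2) (Set.uIoc 0 a) := by
    intro x hx
    rw [Set.uIoc_of_le ha.1] at hx
    simp [kern, hx.2]
  have e1 : Set.EqOn (fun x => (1 - x) ^ 2) (fun x => kern a x ^ 2) (Set.uIoc a 1) := by
    intro x hx
    rw [Set.uIoc_of_le ha.2] at hx
    simp only [kern, not_le.2 hx.1, if_false]
  have hK0 : IntervalIntegrable (fun x => kern a x ^ 2) volume 0 a :=
    (Continuous.intervalIntegrable (by fun_prop) _ _ : IntervalIntegrable (fun x : ℝ => x ^ 2)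
      volume 0 a).congr e0
  have hK1 : IntervalIntegrable (fun x => kern a x ^ 2) volume a 1 :=
    (Continuous.intervalIntegrable (by fun_prop) _ _ : IntervalIntegrable
      (fun x : ℝ => (1 - x) ^ 2) volume a 1).congr e1
  rw [← intervalIntegral.integral_add_adjacent_intervals hK0 hK1,
    ← intervalIntegral_congr e0, ← intervalIntegral_congr e1,
    intervalIntegral.integral_comp_sub_left (fun x => x ^ 2) 1]
  simp only [integral_pow]
  norm_num
  ring

theorem measurable_kern (a : ℝ) : Measurable (kern a) :=
  Measurable.ite measurableSet_Iic measurable_neg (measurable_const.sub measurable_id)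

theorem abs_kern_le (a : ℝ) (t : unitInterval) : |kern a t| ≤ 1 := by
  have := t.2.1
  have := t.2.2
  unfold kern
  split_ifs <;> rw [abs_le] <;> constructor <;> linarith

theorem integral_unitInterval (F : ℝ → ℝ) :
    ∫ t : unitInterval, F t = ∫ x in (0 : ℝ)..1, F x := by
  rw [intervalIntegral.integral_of_le zero_le_one, ← integral_Icc_eq_integral_Ioc]
  exact integral_subtype measurableSet_Icc F

theorem intervalIntegrable_of_unitInterval {W : unitInterval → ℝ} (hW : Integrable W) :
    IntervalIntegrable (fun x => W (Set.projIcc 0 1 zero_le_one x)) volume 0 1 := by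
  rw [intervalIntegrable_iff_integrableOn_Icc_of_le zero_le_one, IntegrableOn,
    ← unitInterval.measurePreserving_coe.map_eq,
    unitInterval.measurableEmbedding_coe.integrable_map_iff]
  refine hW.congr (Eventually.of_forall fun t => ?_)
  simp

theorem integral_sub_eval_unitInterval {H W : unitInterval → ℝ} (hH : Continuous H)
    (hW : Integrable W)
    (h : ∀ ψ, IsIntervalTest ψ →
      ∫ t : unitInterval, H t * deriv ψ t = -∫ t : unitInterval, W t * ψ t) (a : unitInterval) :
    (∫ t, H t) - H a = ∫ t : unitInterval, W t * kern a t := by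
  have := integral_sub_eval_of_weakDeriv (H := fun x => H (Set.projIcc 0 1 zero_le_one x))
    (hH.comp continuous_projIcc).continuousOn (intervalIntegrable_of_unitInterval hW)
    (fun ψ hψ => by
      rw [← integral_unitInterval
          (fun x => H (Set.projIcc 0 1 zero_le_one x) * deriv ψ x),
        ← integral_unitInterval (fun x => W (Set.projIcc 0 1 zero_le_one x) * ψ x)]
      simpa using h ψ hψ) a.2
  rw [← integral_unitInterval (fun x => H (Set.projIcc 0 1 zero_le_one x)),
    ← integral_unitInterval (fun x => W (Set.projIcc 0 1 zero_le_one x) * kern a x)] at this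
  simpa using this

/-- The constant `1` is not a test function, so the integrands are first shown to agree almost
everywhere. -/
theorem integral_eq_of_forall_intervalTest {H W : unitInterval → ℝ} (hH : Integrable H)
    (hW : Integrable W)
    (h : ∀ ψ, IsIntervalTest ψ → ∫ t : unitInterval, H t * ψ t = ∫ t : unitInterval, W t * ψ t) :
    ∫ t, H t = ∫ t, W t := by
  have h1 := (intervalIntegrable_of_unitInterval hH).sub (intervalIntegrable_of_unitInterval hW)
  have h2 := ae_eq_zero_of_integral_mul_intervalTest h1 fun ψ hψ => by
    rw [← integral_unitInterval (fun x => (H (Set.projIcc 0 1 zero_le_one x)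
      - W (Set.projIcc 0 1 zero_le_one x)) * ψ x)]
    obtain ⟨C, hC⟩ := hψ.smooth.continuous.bounded_above_of_compact_support hψ.isCompact
    have hm : AEStronglyMeasurable (fun t : unitInterval => ψ t) :=
      (hψ.smooth.continuous.comp continuous_subtype_val).aestronglyMeasurable
    simp only [Set.projIcc_val, sub_mul]
    rw [integral_sub (hH.mul_bdd hm (Eventually.of_forall fun t => hC t))
      (hW.mul_bdd hm (Eventually.of_forall fun t => hC t)), h ψ hψ, sub_self]
  have h3 : ∫ x in (0 : ℝ)..1, (H (Set.projIcc 0 1 zero_le_one x)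
      - W (Set.projIcc 0 1 zero_le_one x)) = 0 := by
    rw [intervalIntegral.integral_of_le zero_le_one, integral_Ioc_eq_integral_Ioo]
    exact setIntegral_eq_zero_of_ae_eq_zero h2
  rw [← integral_unitInterval (fun x => (H (Set.projIcc 0 1 zero_le_one x)
      - W (Set.projIcc 0 1 zero_le_one x)))] at h3
  simp only [Set.projIcc_val] at h3
  rw [integral_sub hH hW] at h3
  linarith

theorem integral_deriv_intervalTest {ψ : ℝ → ℝ} (hψ : ContDiff ℝ 1 ψ) (h0 : ψ 0 = 0)
    (h1 : ψ 1 = 0) : ∫ t : unitInterval, deriv ψ t = 0 := by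
  rw [integral_unitInterval, intervalIntegral.integral_deriv_eq_sub, h0, h1, sub_zero]
  · exact fun x _ => hψ.differentiable one_ne_zero x
  · exact (hψ.continuous_deriv le_rfl).intervalIntegrable _ _

/-! ## Mixed partial derivatives of test functions -/

section Partial

variable {ι κ : Type}

/-- The partial derivative of a function on `ℝ^ι` in the direction `k`. -/
noncomputable def partialDeriv (k : ι) (φ : (ι → ℝ) → ℝ) : (ι → ℝ) → ℝ := by
  classical
  exact fun x => lineDeriv ℝ φ x (Pi.single k 1)

theorem mixedPartial_eq_foldr (S : Finset ι) (φ : (ι → ℝ) → ℝ) :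
    mixedPartial S φ = S.toList.foldr partialDeriv φ := rfl

theorem mixedPartial_empty (φ : (ι → ℝ) → ℝ) : mixedPartial ∅ φ = φ := by
  simp [mixedPartial_eq_foldr]

theorem isCompact_of_isClosed_subset_cube {K : Set (ι → ℝ)} (hK : IsClosed K)
    (h : K ⊆ {x | ∀ k, x k ∈ Set.Ioo (0 : ℝ) 1}) : IsCompact K := by
  refine (isCompact_univ_pi fun _ : ι => isCompact_Icc (a := (0 : ℝ)) (b := 1)).of_isClosed_subset
    hK fun x hx k _ => Set.Ioo_subset_Icc_self (h hx k)

/-- The product of a function of the variables in the range of `e` and a function of the `j`-th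
variable. -/
def tensor (e : κ ↪ ι) (j : ι) (φ : (κ → ℝ) → ℝ) (ψ : ℝ → ℝ) : (ι → ℝ) → ℝ :=
  fun x => φ (fun k => x (e k)) * ψ (x j)

theorem partialDeriv_tensor_right (e : κ ↪ ι) {j : ι} (hj : ∀ k, e k ≠ j)
    (φ : (κ → ℝ) → ℝ) (ψ : ℝ → ℝ) :
    partialDeriv j (tensor e j φ ψ) = tensor e j φ (deriv ψ) := by
  classical
  funext x
  have h : ∀ t : ℝ, tensor e j φ ψ (x + t • Pi.single j 1)
      = φ (fun i => x (e i)) * ψ (x j + t) := fun t => by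
    unfold tensor
    congr 2
    · funext i
      simp [hj i]
    · simp
  have h' : deriv (fun t => φ (fun i => x (e i)) * ψ (x j + t)) 0
      = φ (fun i => x (e i)) * deriv ψ (x j) := by
    rw [deriv_const_mul_field, deriv_comp_const_add, add_zero]
  simp only [partialDeriv, lineDeriv]
  rw [tensor, ← h']
  congr 1
  funext t
  exact h t

theorem partialDeriv_tensor_left (e : κ ↪ ι) {j : ι} (hj : ∀ k, e k ≠ j) (k : κ)
    (φ : (κ → ℝ) → ℝ) (ψ : ℝ → ℝ) :
    partialDeriv (e k) (tensor e j φ ψ) = tensor e j (partialDeriv k φ) ψ := by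
  classical
  funext x
  have h : ∀ t : ℝ, tensor e j φ ψ (x + t • Pi.single (e k) 1)
      = φ ((fun i => x (e i)) + t • Pi.single k 1) * ψ (x j) := fun t => by
    unfold tensor
    congr 2
    · funext i
      by_cases hi : i = k
      · subst hi; simp
      · simp [hi]
    · simp [(hj k).symm]
  simp only [partialDeriv, tensor, lineDeriv]
  rw [← deriv_mul_const_field]
  congr 1
  funext t
  exact h t

variable [Fintype ι] [Fintype κ]

theorem partialDeriv_eq_fderiv [DecidableEq ι] {φ : (ι → ℝ) → ℝ} (h : ContDiff ℝ (⊤ : ℕ∞) φ)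
    (k : ι) : partialDeriv k φ = fun x => fderiv ℝ φ x (Pi.single k 1) := by
  funext x
  unfold partialDeriv
  convert DifferentiableAt.lineDeriv_eq_fderiv (h.differentiable (by simp) x)

theorem contDiff_partialDeriv {φ : (ι → ℝ) → ℝ} (h : ContDiff ℝ (⊤ : ℕ∞) φ) (k : ι) :
    ContDiff ℝ (⊤ : ℕ∞) (partialDeriv k φ) := by
  classical
  rw [partialDeriv_eq_fderiv h]
  exact (h.fderiv_right (by simp)).clm_apply contDiff_const

theorem partialDeriv_comm {φ : (ι → ℝ) → ℝ} (h : ContDiff ℝ (⊤ : ℕ∞) φ) (k l : ι) :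
    partialDeriv k (partialDeriv l φ) = partialDeriv l (partialDeriv k φ) := by
  classical
  rw [partialDeriv_eq_fderiv (contDiff_partialDeriv h l),
    partialDeriv_eq_fderiv (contDiff_partialDeriv h k), partialDeriv_eq_fderiv h,
    partialDeriv_eq_fderiv h]
  funext x
  have hd : DifferentiableAt ℝ (fderiv ℝ φ) x :=
    (h.fderiv_right (m := (⊤ : ℕ∞)) (by simp)).differentiable (by simp) x
  rw [fderiv_clm_apply hd (differentiableAt_const _), fderiv_clm_apply hd (differentiableAt_const _)]
  simp only [fderiv_fun_const, Pi.zero_apply, ContinuousLinearMap.comp_zero, zero_add,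
    ContinuousLinearMap.flip_apply]
  exact (h.contDiffAt.isSymmSndFDerivAt (by
    rw [minSmoothness_of_isRCLikeNormedField]; exact WithTop.coe_le_coe.2 (le_top (a := (2 : ℕ∞))))) _ _

theorem contDiff_foldr_partialDeriv {φ : (ι → ℝ) → ℝ} (h : ContDiff ℝ (⊤ : ℕ∞) φ) (l : List ι) :
    ContDiff ℝ (⊤ : ℕ∞) (l.foldr partialDeriv φ) := by
  induction l with
  | nil => exact h
  | cons k l ih => exact contDiff_partialDeriv ih k

/-- `mixedPartial` differentiates in the arbitrary order of `S.toList`; symmetry of second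
derivatives removes this choice, so that any variable can be made the outermost one. -/
theorem foldr_partialDeriv_perm {φ : (ι → ℝ) → ℝ} (h : ContDiff ℝ (⊤ : ℕ∞) φ) {l l' : List ι}
    (hl : l.Perm l') : l.foldr partialDeriv φ = l'.foldr partialDeriv φ := by
  induction hl with
  | nil => rfl
  | cons k _ ih => simp [ih]
  | swap k k' l => exact partialDeriv_comm (contDiff_foldr_partialDeriv h l) _ _
  | trans _ _ ih1 ih2 => exact ih1.trans ih2

theorem mixedPartial_insert [DecidableEq ι] {φ : (ι → ℝ) → ℝ} (h : ContDiff ℝ (⊤ : ℕ∞) φ)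
    {S : Finset ι} {k : ι} (hk : k ∉ S) :
    mixedPartial (insert k S) φ = partialDeriv k (mixedPartial S φ) := by
  rw [mixedPartial_eq_foldr, foldr_partialDeriv_perm h (Finset.toList_insert hk)]
  rfl

theorem tsupport_partialDeriv_subset {φ : (ι → ℝ) → ℝ} (h : ContDiff ℝ (⊤ : ℕ∞) φ) (k : ι) :
    tsupport (partialDeriv k φ) ⊆ tsupport φ := by
  classical
  rw [partialDeriv_eq_fderiv h]
  refine (closure_mono ?_).trans (tsupport_fderiv_subset ℝ (f := φ))
  intro x hx hx'
  exact hx (by simp [hx'])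

theorem IsTestFunction.partialDeriv {φ : (ι → ℝ) → ℝ} (h : IsTestFunction φ) (k : ι) :
    IsTestFunction (partialDeriv k φ) := by
  have h' := (tsupport_partialDeriv_subset h.smooth k).trans h.support
  exact ⟨contDiff_partialDeriv h.smooth k,
    isCompact_of_isClosed_subset_cube (isClosed_tsupport _) h', h'⟩

theorem IsTestFunction.mixedPartial {φ : (ι → ℝ) → ℝ} (h : IsTestFunction φ) (S : Finset ι) :
    IsTestFunction (mixedPartial S φ) := by
  rw [mixedPartial_eq_foldr]
  induction S.toList with
  | nil => exact h
  | cons k l ih => exact ih.partialDeriv k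

theorem IsTestFunction.eq_zero {φ : (ι → ℝ) → ℝ} (h : IsTestFunction φ) {x : ι → ℝ} {k : ι}
    (hx : x k ∉ Set.Ioo (0 : ℝ) 1) : φ x = 0 :=
  image_eq_zero_of_notMem_tsupport fun h' => hx (h.support h' k)

theorem contDiff_tensor (e : κ ↪ ι) (j : ι) {φ : (κ → ℝ) → ℝ} (hφ : ContDiff ℝ (⊤ : ℕ∞) φ)
    {ψ : ℝ → ℝ} (hψ : ContDiff ℝ (⊤ : ℕ∞) ψ) : ContDiff ℝ (⊤ : ℕ∞) (tensor e j φ ψ) :=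
  (hφ.comp (contDiff_pi.2 fun k => contDiff_apply ℝ ℝ (e k))).mul
    (hψ.comp (contDiff_apply ℝ ℝ j))

theorem IsTestFunction.tensor (e : κ ↪ ι) {j : ι} (hj : ∀ i, i = j ∨ ∃ k, e k = i)
    {φ : (κ → ℝ) → ℝ} (hφ : IsTestFunction φ) {ψ : ℝ → ℝ} (hψ : IsIntervalTest ψ) :
    IsTestFunction (tensor e j φ ψ) := by
  have hs : tsupport (AnovaAnchored.tensor e j φ ψ)
      ⊆ {x | (fun k => x (e k)) ∈ tsupport φ ∧ x j ∈ tsupport ψ} := by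
    refine closure_minimal ?_ (((isClosed_tsupport φ).preimage (by fun_prop)).inter
      ((isClosed_tsupport ψ).preimage (by fun_prop)))
    intro x hx
    have := mul_ne_zero_iff.1 hx
    exact ⟨subset_closure this.1, subset_closure this.2⟩
  have hs' : tsupport (AnovaAnchored.tensor e j φ ψ) ⊆ {x | ∀ k, x k ∈ Set.Ioo (0 : ℝ) 1} := by
    intro x hx i
    rcases hj i with rfl | ⟨k, rfl⟩
    · exact hψ.support (hs hx).2
    · exact hφ.support (hs hx).1 k
  exact ⟨contDiff_tensor e j hφ.smooth hψ.smooth,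
    isCompact_of_isClosed_subset_cube (isClosed_tsupport _) hs', hs'⟩

theorem mixedPartial_map_tensor (e : κ ↪ ι) {j : ι} (hj : ∀ k, e k ≠ j) {φ : (κ → ℝ) → ℝ}
    (hφ : ContDiff ℝ (⊤ : ℕ∞) φ) {ψ : ℝ → ℝ} (hψ : ContDiff ℝ (⊤ : ℕ∞) ψ) (S : Finset κ) :
    mixedPartial (S.map e) (tensor e j φ ψ) = tensor e j (mixedPartial S φ) ψ := by
  classical
  induction S using Finset.induction_on with
  | empty => simp [mixedPartial_empty]
  | insert k S hk ih =>
    rw [Finset.map_insert, mixedPartial_insert (contDiff_tensor e j hφ hψ) (by simpa using hk), ih,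
      partialDeriv_tensor_left e hj, mixedPartial_insert hφ hk]

theorem mixedPartial_insert_map_tensor [DecidableEq ι] (e : κ ↪ ι) {j : ι} (hj : ∀ k, e k ≠ j)
    {φ : (κ → ℝ) → ℝ} (hφ : ContDiff ℝ (⊤ : ℕ∞) φ) {ψ : ℝ → ℝ} (hψ : ContDiff ℝ (⊤ : ℕ∞) ψ)
    (S : Finset κ) :
    mixedPartial (insert j (S.map e)) (tensor e j φ ψ) = tensor e j (mixedPartial S φ) (deriv ψ) := by
  rw [mixedPartial_insert (contDiff_tensor e j hφ hψ) (by simpa using fun k _ => hj k),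
    mixedPartial_map_tensor e hj hφ hψ, partialDeriv_tensor_right e hj]

theorem integral_partialDeriv_update [DecidableEq ι] {φ : (ι → ℝ) → ℝ} (h : IsTestFunction φ)
    (j : ι) (x : ι → ℝ) :
    ∫ t : unitInterval, partialDeriv j φ (Function.update x j t) = 0 := by
  have hd : ∀ t : ℝ, partialDeriv j φ (Function.update x j t)
      = deriv (fun s => φ (Function.update x j s)) t := fun t => by
    have h2 : ∀ s : ℝ, φ (Function.update x j t + s • Pi.single j 1)
        = φ (Function.update x j (t + s)) := fun s => by
      congr 1
      funext i
      by_cases hi : i = j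
      · subst hi; simp
      · simp [hi]
    have h3 := deriv_comp_const_add (fun s => φ (Function.update x j s)) t 0
    rw [add_zero] at h3
    rw [← h3]
    simp only [partialDeriv, lineDeriv]
    congr 1
    funext s
    convert h2 s
  simp_rw [hd]
  refine integral_deriv_intervalTest ?_ (h.eq_zero (k := j) (by simp)) (h.eq_zero (k := j) (by simp))
  exact (h.smooth.of_le (by simp)).comp (contDiff_update 1 x j)

end Partial

/-! ## Fubini theorems on the infinite cube -/

instance : IsProbabilityMeasure cubeMeasure := by
  unfold cubeMeasure; infer_instance

open Classical in
/-- The point with the coordinates of `t` on `σ` and those of `x` off `σ`. -/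
noncomputable def splice (σ : Set ℕ) (t x : ℕ → unitInterval) : ℕ → unitInterval := σ.piecewise t x

theorem avg_apply (σ : Set ℕ) (f : (ℕ → unitInterval) → ℝ) (x : ℕ → unitInterval) :
    avg σ f x = ∫ t, f (splice σ t x) ∂cubeMeasure := rfl

theorem anchorAt_apply (xs : unitInterval) (σ : Set ℕ) (f : (ℕ → unitInterval) → ℝ)
    (x : ℕ → unitInterval) : anchorAt xs σ f x = f (splice σ (fun _ => xs) x) := rfl

theorem splice_of_mem {σ : Set ℕ} {k : ℕ} (h : k ∈ σ) (t x : ℕ → unitInterval) :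
    splice σ t x k = t k := by
  simp [splice, h]

theorem splice_of_notMem {σ : Set ℕ} {k : ℕ} (h : k ∉ σ) (t x : ℕ → unitInterval) :
    splice σ t x k = x k := by
  simp [splice, h]

theorem continuous_splice (σ : Set ℕ) :
    Continuous fun p : (ℕ → unitInterval) × (ℕ → unitInterval) => splice σ p.1 p.2 := by
  refine continuous_pi fun k => ?_
  by_cases h : k ∈ σ
  · simp only [splice_of_mem h]; fun_prop
  · simp only [splice_of_notMem h]; fun_prop

/-- Two independent uniform points merged along any, possibly infinite, set of coordinates again
form a uniform point. On a box this is a product split according to `σ`. It is the source of all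
Fubini arguments on the infinite cube. -/
theorem measurePreserving_splice (σ : Set ℕ) :
    MeasurePreserving (fun p : (ℕ → unitInterval) × (ℕ → unitInterval) => splice σ p.1 p.2)
      (cubeMeasure.prod cubeMeasure) cubeMeasure := by
  classical
  have hm := (continuous_splice σ).measurable
  refine ⟨hm, Measure.eq_infinitePi _ fun s t ht => ?_⟩
  rw [Measure.map_apply hm (MeasurableSet.pi s.countable_toSet fun i _ => ht i)]
  have : (fun p : (ℕ → unitInterval) × (ℕ → unitInterval) => splice σ p.1 p.2) ⁻¹' (s : Set ℕ).pi t
      = ((s.filter (· ∈ σ) : Finset ℕ) : Set ℕ).pi t ×ˢ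
        ((s.filter (· ∉ σ) : Finset ℕ) : Set ℕ).pi t := by
    ext ⟨x, y⟩
    simp only [Set.mem_preimage, Set.mem_pi, Set.mem_prod, Finset.mem_coe, Finset.mem_filter]
    constructor
    · intro h
      refine ⟨fun k hk => ?_, fun k hk => ?_⟩
      · have := h k hk.1
        rwa [splice_of_mem hk.2] at this
      · have := h k hk.1
        rwa [splice_of_notMem hk.2] at this
    · rintro ⟨h1, h2⟩ k hk
      by_cases hkσ : k ∈ σ
      · rw [splice_of_mem hkσ]; exact h1 k ⟨hk, hkσ⟩
      · rw [splice_of_notMem hkσ]; exact h2 k ⟨hk, hkσ⟩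
  rw [this, Measure.prod_prod, cubeMeasure, Measure.infinitePi_pi _ fun i _ => ht i,
    Measure.infinitePi_pi _ fun i _ => ht i, Finset.prod_filter_mul_prod_filter_not]

theorem measurePreserving_update (j : ℕ) :
    MeasurePreserving (fun p : (ℕ → unitInterval) × unitInterval => Function.update p.1 j p.2)
      (cubeMeasure.prod volume) cubeMeasure := by
  have hm : Measurable
      (fun p : (ℕ → unitInterval) × unitInterval => Function.update p.1 j p.2) :=
    (Continuous.update continuous_fst j continuous_snd).measurable
  have h1 : MeasurePreserving (fun p : (ℕ → unitInterval) × (ℕ → unitInterval) => (p.1, p.2 j))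
      (cubeMeasure.prod cubeMeasure) (cubeMeasure.prod volume) :=
    (MeasurePreserving.id cubeMeasure).prod (measurePreserving_eval_infinitePi _ j)
  refine ⟨hm, ?_⟩
  rw [← h1.map_eq, Measure.map_map hm h1.measurable]
  have h2 := (measurePreserving_splice {j}).comp
    (Measure.measurePreserving_swap (μ := cubeMeasure) (ν := cubeMeasure))
  convert h2.map_eq using 2
  funext p
  funext k
  by_cases hk : k = j
  · subst hk; simp [splice]
  · simp [splice, hk]

theorem measurePreserving_restrict (ω : Finset ℕ) :
    MeasurePreserving (fun (x : ℕ → unitInterval) (k : ω) => x k) cubeMeasure volume :=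
  ⟨by fun_prop, Measure.infinitePi_map_restrict (fun _ => (volume : Measure unitInterval))⟩

theorem integrable_of_continuous {X : Type*} [TopologicalSpace X] [CompactSpace X]
    [MeasurableSpace X] [OpensMeasurableSpace X] {μ : Measure X} [IsFiniteMeasure μ] {F : X → ℝ}
    (hF : Continuous F) : Integrable F μ :=
  hF.integrable_of_hasCompactSupport (HasCompactSupport.of_compactSpace F)

theorem exists_bound_of_continuous {X : Type*} [TopologicalSpace X] [CompactSpace X]
    {F : X → ℝ} (hF : Continuous F) : ∃ C, ∀ x, ‖F x‖ ≤ C := by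
  obtain ⟨C, hC⟩ := isCompact_univ.exists_bound_of_continuousOn hF.continuousOn
  exact ⟨C, fun x => hC x trivial⟩

theorem MeasurePreserving.integral_comp_eq {X Y : Type*} [MeasurableSpace X] [MeasurableSpace Y]
    {μ : Measure X} {ν : Measure Y} {m : X → Y} (hm : MeasurePreserving m μ ν) {F : Y → ℝ}
    (hF : AEStronglyMeasurable F ν) : ∫ x, F (m x) ∂μ = ∫ y, F y ∂ν := by
  rw [← hm.map_eq] at hF ⊢
  rw [integral_map hm.measurable.aemeasurable hF]

theorem integral_splice (σ : Set ℕ) {F : (ℕ → unitInterval) → ℝ} (hF : Integrable F cubeMeasure) :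
    ∫ x, ∫ t, F (splice σ t x) ∂cubeMeasure ∂cubeMeasure = ∫ x, F x ∂cubeMeasure := by
  have h := measurePreserving_splice σ
  rw [← MeasurePreserving.integral_comp_eq h hF.1]
  exact (integral_prod_symm _ (h.integrable_comp_of_integrable hF)).symm

theorem integral_update (j : ℕ) {F : (ℕ → unitInterval) → ℝ} (hF : Integrable F cubeMeasure) :
    ∫ x, (∫ t, F (Function.update x j t)) ∂cubeMeasure = ∫ x, F x ∂cubeMeasure := by
  have h := measurePreserving_update j
  rw [← MeasurePreserving.integral_comp_eq h hF.1]
  exact (integral_prod _ (h.integrable_comp_of_integrable hF)).symm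

theorem integrable_slice (j : ℕ) {B : (ℕ → unitInterval) → ℝ} (hB : Integrable B cubeMeasure) :
    Integrable fun t => ∫ x, B (Function.update x j t) ∂cubeMeasure :=
  ((measurePreserving_update j).integrable_comp_of_integrable hB).integral_prod_right

/-- Resampling the `j`-th coordinate turns a pairing with a function of `x_j` into a one-dimensional
pairing of the slice integral. This is the bridge to weak derivatives on the interval. -/
theorem integral_mul_coord (j : ℕ) {B : (ℕ → unitInterval) → ℝ} (hB : Integrable B cubeMeasure)
    {ψ : unitInterval → ℝ} (hψ : Measurable ψ) {C : ℝ} (hC : ∀ t, ‖ψ t‖ ≤ C) :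
    ∫ x, B x * ψ (x j) ∂cubeMeasure
      = ∫ t, (∫ x, B (Function.update x j t) ∂cubeMeasure) * ψ t := by
  have h := measurePreserving_update j
  have hm : Integrable (fun x : ℕ → unitInterval => B x * ψ (x j)) cubeMeasure :=
    hB.mul_bdd (c := C) (hψ.comp (measurable_pi_apply j)).aestronglyMeasurable
      (Eventually.of_forall fun x => hC (x j))
  rw [← MeasurePreserving.integral_comp_eq h hm.1]
  refine (integral_prod_symm _ (h.integrable_comp_of_integrable hm)).trans ?_
  simp [integral_mul_const]

theorem IsIntervalTest.exists_bound {ψ : ℝ → ℝ} (hψ : IsIntervalTest ψ) :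
    ∃ C, ∀ t : unitInterval, ‖ψ t‖ ≤ C :=
  exists_bound_of_continuous (hψ.smooth.continuous.comp continuous_subtype_val)

theorem IsIntervalTest.measurable_coe {ψ : ℝ → ℝ} (hψ : IsIntervalTest ψ) :
    Measurable fun t : unitInterval => ψ t :=
  (hψ.smooth.continuous.comp continuous_subtype_val).measurable

theorem continuous_slice (j : ℕ) {B : (ℕ → unitInterval) → ℝ} (hB : Continuous B) :
    Continuous fun t => ∫ x, B (Function.update x j t) ∂cubeMeasure := by
  obtain ⟨C, hC⟩ := exists_bound_of_continuous hB
  refine continuous_of_dominated (bound := fun _ => C) (fun t => ?_)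
    (fun t => Eventually.of_forall fun x => hC _) (integrable_const C)
    (Eventually.of_forall fun x => ?_)
  · exact (hB.comp (continuous_id.update j continuous_const)).aestronglyMeasurable
  · exact hB.comp (continuous_const.update j continuous_id)

theorem integral_eq_integral_slice (j : ℕ) {B : (ℕ → unitInterval) → ℝ}
    (hB : Integrable B cubeMeasure) :
    ∫ x, B x ∂cubeMeasure = ∫ t, ∫ x, B (Function.update x j t) ∂cubeMeasure := by
  simpa using integral_mul_coord j hB (ψ := fun _ => 1) measurable_const (C := 1) (by simp)

/-- The slice integral of `B` is continuous, with weak derivative the slice integral of `D`, so the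
one-variable identity applies to it. -/
theorem integral_sub_anchor (j : ℕ) {B D : (ℕ → unitInterval) → ℝ} (hB : Continuous B)
    (hD : Integrable D cubeMeasure)
    (h : ∀ ψ, IsIntervalTest ψ →
      ∫ x, B x * deriv ψ (x j) ∂cubeMeasure = -∫ x, D x * ψ (x j) ∂cubeMeasure)
    (a : unitInterval) :
    (∫ x, B x ∂cubeMeasure) - ∫ x, B (Function.update x j a) ∂cubeMeasure
      = ∫ x, D x * kern a (x j) ∂cubeMeasure := by
  have hBi : Integrable B cubeMeasure := integrable_of_continuous hB
  rw [integral_eq_integral_slice j hBi,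
    integral_mul_coord j hD (ψ := fun t => kern a t) ((measurable_kern a).comp measurable_subtype_coe)
      (C := 1) (abs_kern_le a)]
  refine integral_sub_eval_unitInterval (continuous_slice j hB) (integrable_slice j hD)
    (fun ψ hψ => ?_) a
  obtain ⟨C, hC⟩ := hψ.exists_bound
  obtain ⟨C', hC'⟩ := hψ.deriv.exists_bound
  rw [← integral_mul_coord j hD hψ.measurable_coe hC,
    ← integral_mul_coord j hBi hψ.deriv.measurable_coe hC', h ψ hψ]

theorem integral_eq_of_forall_coord_test (j : ℕ) {B D : (ℕ → unitInterval) → ℝ}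
    (hB : Integrable B cubeMeasure) (hD : Integrable D cubeMeasure)
    (h : ∀ ψ, IsIntervalTest ψ →
      ∫ x, B x * ψ (x j) ∂cubeMeasure = ∫ x, D x * ψ (x j) ∂cubeMeasure) :
    ∫ x, B x ∂cubeMeasure = ∫ x, D x ∂cubeMeasure := by
  rw [integral_eq_integral_slice j hB, integral_eq_integral_slice j hD]
  refine integral_eq_of_forall_intervalTest (integrable_slice j hB) (integrable_slice j hD)
    fun ψ hψ => ?_
  obtain ⟨C, hC⟩ := hψ.exists_bound
  rw [← integral_mul_coord j hD hψ.measurable_coe hC,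
    ← integral_mul_coord j hB hψ.measurable_coe hC, h ψ hψ]

theorem integral_prod_kern_sq (a : unitInterval) (σ : Finset ℕ) :
    ∫ x, (∏ k ∈ σ, kern a (x k)) ^ 2 ∂cubeMeasure = anchorConst a ^ σ.card := by
  have h1 : ∀ x : ℕ → unitInterval, (∏ k ∈ σ, kern a (x k)) ^ 2
      = ∏ k : σ, (fun t : unitInterval => kern a t ^ 2) (x k) := fun x => by
    rw [← Finset.prod_pow, Finset.prod_coe_sort σ (fun k => kern a (x k) ^ 2)]
  simp_rw [h1]
  rw [MeasurePreserving.integral_comp_eq (measurePreserving_restrict σ)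
    (F := fun y : σ → unitInterval => ∏ k : σ, (fun t : unitInterval => kern a t ^ 2) (y k)),
    integral_fintype_prod_volume_eq_prod (ι := σ) (E := fun _ => unitInterval)
      (fun _ t => kern a t ^ 2)]
  · have h2 : ∫ t : unitInterval, kern a t ^ 2 = anchorConst a := by
      rw [integral_unitInterval (fun t => kern a t ^ 2), integral_kern_sq a.2, anchorConst]
    simp [h2]
  · refine Measurable.aestronglyMeasurable (Finset.measurable_fun_prod _ fun k _ => ?_)
    exact ((measurable_kern a).comp (measurable_subtype_coe.comp (measurable_pi_apply k))).pow_const 2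

/-! ## Weak derivatives on the infinite cube, tested against functions of finitely many variables -/

/-- The real coordinates of a point with indices in `ω`. -/
def coords (ω : Finset ℕ) (x : ℕ → unitInterval) : ω → ℝ := fun k => (x k : ℝ)

theorem continuous_coords (ω : Finset ℕ) : Continuous (coords ω) :=
  continuous_pi fun k => continuous_subtype_val.comp (continuous_apply (k : ℕ))

theorem coords_congr {ω : Finset ℕ} {x y : ℕ → unitInterval} (h : ∀ k ∈ ω, x k = y k) :
    coords ω x = coords ω y :=
  funext fun k => by simp [coords, h k k.2]

theorem coords_update_of_notMem {ω : Finset ℕ} {j : ℕ} (hj : j ∉ ω) (x : ℕ → unitInterval)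
    (t : unitInterval) : coords ω (Function.update x j t) = coords ω x :=
  coords_congr fun k hk => by rw [Function.update_of_ne]; rintro rfl; exact hj hk

theorem coords_update_of_mem {ω : Finset ℕ} {j : ℕ} (hj : j ∈ ω) (x : ℕ → unitInterval)
    (t : unitInterval) :
    coords ω (Function.update x j t) = Function.update (coords ω x) ⟨j, hj⟩ t := by
  funext k
  by_cases hk : k = ⟨j, hj⟩
  · subst hk; simp [coords]
  · have : (k : ℕ) ≠ j := fun h => hk (Subtype.ext h)
    simp [coords, hk, this]

/-- `V` is square integrable, and integrates against functions of the variables in `ω` like the mixed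
derivative of `F` with respect to the variables in `S ⊆ ω`. -/
structure HasCylWeakDeriv (ω S : Finset ℕ) (F V : (ℕ → unitInterval) → ℝ) : Prop where
  memLp : MemLp V 2 cubeMeasure
  integral_eq : ∀ φ : (ω → ℝ) → ℝ, IsTestFunction φ →
    ∫ x, F x * mixedPartial (S.subtype (· ∈ ω)) φ (coords ω x) ∂cubeMeasure
      = (-1) ^ S.card * ∫ x, V x * φ (coords ω x) ∂cubeMeasure

theorem IsTestFunction.continuous_comp_coords {ω : Finset ℕ} {φ : (ω → ℝ) → ℝ}
    (hφ : IsTestFunction φ) : Continuous fun x => φ (coords ω x) :=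
  hφ.smooth.continuous.comp (continuous_coords ω)

theorem integrable_mul_continuous {V G : (ℕ → unitInterval) → ℝ} (hV : MemLp V 2 cubeMeasure)
    (hG : Continuous G) : Integrable (fun x => V x * G x) cubeMeasure := by
  obtain ⟨C, hC⟩ := exists_bound_of_continuous hG
  exact (hV.integrable one_le_two).mul_bdd hG.aestronglyMeasurable (Eventually.of_forall hC)

theorem memLp_mul_of_abs_le_one {V K : (ℕ → unitInterval) → ℝ} (hV : MemLp V 2 cubeMeasure)
    (hK : Measurable K) (hK1 : ∀ x, ‖K x‖ ≤ 1) : MemLp (fun x => V x * K x) 2 cubeMeasure := by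
  refine hV.of_le (hV.1.mul hK.aestronglyMeasurable) (Eventually.of_forall fun x => ?_)
  rw [norm_mul]
  exact mul_le_of_le_one_right (norm_nonneg _) (hK1 x)

/-- A single `Φ = φ * ψ(x_j)` serves both ways of removing the variable `j`: a derivative in `j`
falls on `ψ` alone, and derivatives in `S` fall on `φ` alone. -/
theorem mixedPartial_tensor_coords {ω S : Finset ℕ} {j : ℕ} (hj : j ∉ ω) (hS : S ⊆ ω)
    {φ : (ω → ℝ) → ℝ} (hφ : IsTestFunction φ) {ψ : ℝ → ℝ} (hψ : IsIntervalTest ψ) :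
    ∃ Φ : (↥(insert j ω : Finset ℕ) → ℝ) → ℝ, IsTestFunction Φ ∧
      (∀ x, Φ (coords (insert j ω) x) = φ (coords ω x) * ψ (x j)) ∧
      (∀ x, mixedPartial (S.subtype (· ∈ insert j ω)) Φ (coords (insert j ω) x)
        = mixedPartial (S.subtype (· ∈ ω)) φ (coords ω x) * ψ (x j)) ∧
      ∀ x, mixedPartial ((insert j S).subtype (· ∈ insert j ω)) Φ (coords (insert j ω) x)
        = mixedPartial (S.subtype (· ∈ ω)) φ (coords ω x) * deriv ψ (x j) := by
  let e : ω ↪ ↥(insert j ω : Finset ℕ) :=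
    ⟨fun k => ⟨k, Finset.mem_insert_of_mem k.2⟩, fun k l h => Subtype.ext (by simpa using h)⟩
  let j' : ↥(insert j ω : Finset ℕ) := ⟨j, Finset.mem_insert_self j ω⟩
  have hj' : ∀ k, e k ≠ j' := fun k h => hj (by
    have : (k : ℕ) = j := congrArg Subtype.val h
    exact this ▸ k.2)
  have h1 : S.subtype (· ∈ insert j ω) = (S.subtype (· ∈ ω)).map e := by
    ext ⟨k, hk⟩
    simp only [Finset.mem_subtype, Finset.mem_map]
    constructor
    · exact fun h => ⟨⟨k, hS h⟩, by simpa using h, rfl⟩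
    · rintro ⟨l, hl, hlk⟩
      have : (l : ℕ) = k := congrArg Subtype.val hlk
      rw [← this]
      simpa using hl
  have h2 : (insert j S).subtype (· ∈ insert j ω) = insert j' ((S.subtype (· ∈ ω)).map e) := by
    rw [← h1]
    ext ⟨k, hk⟩
    simp [j']
  refine ⟨tensor e j' φ ψ, hφ.tensor e (fun i => ?_) hψ, fun x => rfl, fun x => ?_, fun x => ?_⟩
  · rcases Finset.mem_insert.1 i.2 with h | h
    · exact Or.inl (Subtype.ext h)
    · exact Or.inr ⟨⟨i, h⟩, rfl⟩
  · rw [h1, mixedPartial_map_tensor e hj' hφ.smooth hψ.smooth]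
    rfl
  · rw [h2, mixedPartial_insert_map_tensor e hj' hφ.smooth hψ.smooth]
    rfl

/-- Removes a variable in which no derivative is taken. `V` may keep depending on `x_j`, as only its
pairings with functions of the variables in `ω` matter. -/
theorem HasCylWeakDeriv.of_insert {ω S : Finset ℕ} {j : ℕ} (hj : j ∉ ω) (hS : S ⊆ ω)
    {F V : (ℕ → unitInterval) → ℝ} (hF : Continuous F) (h : HasCylWeakDeriv (insert j ω) S F V) :
    HasCylWeakDeriv ω S F V := by
  refine ⟨h.memLp, fun φ hφ => ?_⟩
  rw [← integral_const_mul]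
  refine integral_eq_of_forall_coord_test j
    (integrable_of_continuous (hF.mul (hφ.mixedPartial _).continuous_comp_coords))
    ((integrable_mul_continuous h.memLp hφ.continuous_comp_coords).const_mul _) fun ψ hψ => ?_
  obtain ⟨Φ, hΦ, h1, h2, -⟩ := mixedPartial_tensor_coords hj hS hφ hψ
  have := h.integral_eq Φ hΦ
  simp_rw [h1, h2] at this
  rw [← integral_const_mul] at this
  simpa only [mul_assoc] using this

/-- The multivariate form of the kernel identity: one derivative, in `j`, is traded for the
difference from the anchored value and a factor `kern a (x j)`. -/
theorem HasCylWeakDeriv.sub_update {ω S : Finset ℕ} {j : ℕ} (hj : j ∉ ω) (hS : S ⊆ ω)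
    {F V : (ℕ → unitInterval) → ℝ} (hF : Continuous F)
    (h : HasCylWeakDeriv (insert j ω) (insert j S) F V) (a : unitInterval) :
    HasCylWeakDeriv ω S (fun x => F x - F (Function.update x j a))
      (fun x => V x * kern a (x j)) := by
  have hjS : j ∉ S := fun h => hj (hS h)
  have hk : Measurable (fun x : ℕ → unitInterval => kern a (x j)) :=
    (measurable_kern a).comp (measurable_subtype_coe.comp (measurable_pi_apply j))
  refine ⟨memLp_mul_of_abs_le_one h.memLp hk fun x => abs_kern_le a (x j), fun φ hφ => ?_⟩
  have hu : Continuous fun x : ℕ → unitInterval => Function.update x j a :=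
    continuous_id.update j continuous_const
  have hd := (hφ.mixedPartial (S.subtype (· ∈ ω))).continuous_comp_coords
  -- For fixed `φ`, take `B = F * ∂^S φ` and `D = (-1) ^ |S| * V * φ`; the extra sign in `(-1) ^
  -- |insert j S|` is the minus sign of integration by parts in `x_j`.
  have key := integral_sub_anchor j (hF.mul hd)
    ((integrable_mul_continuous h.memLp hφ.continuous_comp_coords).const_mul ((-1) ^ S.card))
    (fun ψ hψ => by
      obtain ⟨Φ, hΦ, h1, -, h2⟩ := mixedPartial_tensor_coords hj hS hφ hψ
      have := h.integral_eq Φ hΦ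
      simp_rw [h1, h2] at this
      rw [← integral_const_mul, Finset.card_insert_of_notMem hjS] at this
      rw [← integral_neg]
      refine (integral_congr_ae (Eventually.of_forall fun x => ?_)).trans (this.trans ?_)
      · simp only [Pi.mul_apply, mul_assoc]
      · congr 1; ext x; ring) a
  simp only [Pi.mul_apply, coords_update_of_notMem hj] at key
  have h1 := integral_sub (integrable_of_continuous (μ := cubeMeasure) (hF.mul hd))
    (integrable_of_continuous ((hF.comp hu).mul hd))
  simp only [Pi.mul_apply, Function.comp_apply, ← sub_mul] at h1
  rw [← integral_const_mul, h1, key]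
  congr 1
  ext x
  ring

/-- Integrate over `x_j` first: `F` is constant there, and the derivative of a compactly supported
function has integral zero. -/
theorem integral_mul_mixedPartial_eq_zero {ω : Finset ℕ} {j : ℕ} (hj : j ∈ ω)
    {F : (ℕ → unitInterval) → ℝ} (hF : Continuous F)
    (hFj : ∀ x t, F (Function.update x j t) = F x) {φ : (ω → ℝ) → ℝ} (hφ : IsTestFunction φ) :
    ∫ x, F x * mixedPartial (ω.subtype (· ∈ ω)) φ (coords ω x) ∂cubeMeasure = 0 := by
  have hi := integrable_of_continuous (μ := cubeMeasure)
    (hF.mul (hφ.mixedPartial (ω.subtype (· ∈ ω))).continuous_comp_coords)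
  refine (integral_update j hi).symm.trans ?_
  refine integral_eq_zero_of_ae (Eventually.of_forall fun x => ?_)
  simp only [Pi.mul_apply, hFj, coords_update_of_mem hj, Pi.zero_apply]
  rw [integral_const_mul, ← Finset.insert_erase (s := ω.subtype (· ∈ ω)) (a := ⟨j, hj⟩) (by simp),
    mixedPartial_insert hφ.smooth (Finset.notMem_erase _ _),
    integral_partialDeriv_update (hφ.mixedPartial _), mul_zero]

/-- Extension of a point of `[0,1]^ω` by zero. -/
def extendZero (ω : Finset ℕ) (y : ω → unitInterval) : ℕ → unitInterval :=
  fun k => if h : k ∈ ω then y ⟨k, h⟩ else 0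

theorem toCube_apply (ω : Finset ℕ) (F : (ℕ → unitInterval) → ℝ) (y : ω → unitInterval) :
    toCube ω F y = F (extendZero ω y) := rfl

theorem extendZero_restrict {ω : Finset ℕ} (x : ℕ → unitInterval) {k : ℕ} (hk : k ∈ ω) :
    extendZero ω (fun i => x i) k = x k := by
  simp [extendZero, hk]

theorem continuous_extendZero (ω : Finset ℕ) : Continuous (extendZero ω) := by
  refine continuous_pi fun k => ?_
  by_cases hk : k ∈ ω
  · simp only [extendZero, hk, dif_pos]; fun_prop
  · simp only [extendZero, hk, dif_neg, not_false_eq_true]; fun_prop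

theorem toCube_restrict {ω : Finset ℕ} {F : (ℕ → unitInterval) → ℝ} (hF : DependsOn F ω)
    (x : ℕ → unitInterval) : toCube ω F (fun i => x i) = F x :=
  hF fun _ hk => extendZero_restrict x hk

theorem subtype_mem_eq_univ (ω : Finset ℕ) : ω.subtype (· ∈ ω) = Finset.univ := by
  ext ⟨k, hk⟩; simp

theorem IsWeakMixedDeriv.hasCylWeakDeriv {ω S : Finset ℕ} {F : (ℕ → unitInterval) → ℝ}
    (hFc : Continuous F) (hF : DependsOn F ω) (hS : S ⊆ ω) {v : (ω → unitInterval) → ℝ}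
    (h : IsWeakMixedDeriv (S.subtype (· ∈ ω)) (toCube ω F) v) :
    HasCylWeakDeriv ω S F (fun x => v fun i => x i) := by
  have hm := measurePreserving_restrict ω
  refine ⟨h.1.comp_measurePreserving hm, fun φ hφ => ?_⟩
  have h1 := h.2 φ hφ
  have hc : ∀ {φ : (ω → ℝ) → ℝ}, IsTestFunction φ →
      Continuous fun y : ω → unitInterval => φ (fun k => (y k : ℝ)) := fun hφ =>
    hφ.smooth.continuous.comp (by fun_prop)
  rw [← MeasurePreserving.integral_comp_eq hm, ← MeasurePreserving.integral_comp_eq hm,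
    Finset.card_subtype, Finset.filter_true_of_mem hS] at h1
  · simp_rw [toCube_restrict hF] at h1
    exact h1
  · exact h.1.1.mul (hc hφ).aestronglyMeasurable
  · exact ((hFc.comp (continuous_extendZero ω)).mul (hc (hφ.mixedPartial _))).aestronglyMeasurable

theorem enorm_integral_mul_sq_le {X : Type*} [MeasurableSpace X] {μ : Measure X} {f g : X → ℝ}
    (hf : AEMeasurable f μ) (hg : AEMeasurable g μ) :
    ‖∫ x, f x * g x ∂μ‖ₑ ^ 2 ≤ (∫⁻ x, ‖f x‖ₑ ^ 2 ∂μ) * ∫⁻ x, ‖g x‖ₑ ^ 2 ∂μ := by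
  have h1 : ‖∫ x, f x * g x ∂μ‖ₑ ≤ ∫⁻ x, ‖f x‖ₑ * ‖g x‖ₑ ∂μ := by
    simpa only [enorm_mul] using enorm_integral_le_lintegral_enorm (μ := μ) fun x => f x * g x
  have h2 := ENNReal.lintegral_mul_le_Lp_mul_Lq μ Real.HolderConjugate.two_two hf.enorm hg.enorm
  have h3 := pow_le_pow_left₀ zero_le (h1.trans h2) 2
  refine h3.trans (le_of_eq ?_)
  rw [mul_pow, ← ENNReal.rpow_natCast, ← ENNReal.rpow_natCast, ← ENNReal.rpow_mul,
    ← ENNReal.rpow_mul]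
  norm_num

theorem eLpNorm_two_sq {X : Type*} [MeasurableSpace X] {μ : Measure X} (f : X → ℝ) :
    eLpNorm f 2 μ ^ 2 = ∫⁻ x, ‖f x‖ₑ ^ 2 ∂μ := by
  rw [eLpNorm_eq_lintegral_rpow_enorm_toReal (by simp) (by simp), ← ENNReal.rpow_natCast,
    ← ENNReal.rpow_mul]
  norm_num

/-- Averaging `V * ∏ kern` over the variables outside `ω` leaves its pairings unchanged and gives a
genuine weak derivative on the cube of `ω`. The kernels involve only variables outside `ω`, so
Cauchy-Schwarz on each fibre yields `√q ^ |σ|`. -/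
theorem HasCylWeakDeriv.mixedDerivNorm_le {ω σ : Finset ℕ} (hσ : Disjoint σ ω) (a : unitInterval)
    {F V : (ℕ → unitInterval) → ℝ} (hFc : Continuous F) (hF : DependsOn F ω)
    (hV : MemLp V 2 cubeMeasure)
    (h : HasCylWeakDeriv ω ω F (fun x => V x * ∏ k ∈ σ, kern a (x k))) :
    mixedDerivNorm (toCube ω F)
      ≤ ENNReal.ofReal (√(anchorConst a) ^ σ.card) * eLpNorm V 2 cubeMeasure := by
  set K : (ℕ → unitInterval) → ℝ := fun x => ∏ k ∈ σ, kern a (x k) with hK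
  have hKm : Measurable K := Finset.measurable_fun_prod _ fun k _ =>
    (measurable_kern a).comp (measurable_subtype_coe.comp (measurable_pi_apply k))
  have hKb : ∀ x, ‖K x‖ ≤ 1 := fun x => by
    rw [hK, Real.norm_eq_abs, Finset.abs_prod]
    exact Finset.prod_le_one (fun _ _ => abs_nonneg _) fun k _ => abs_kern_le a (x k)
  have hKt : ∀ t x, K (splice (ω : Set ℕ)ᶜ t x) = K t := fun t x =>
    Finset.prod_congr rfl fun k hk => by
      rw [splice_of_mem (by simpa using Finset.disjoint_left.1 hσ hk)]
  have hct : ∀ t x, coords ω (splice (ω : Set ℕ)ᶜ t x) = coords ω x := fun t x =>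
    coords_congr fun k hk => splice_of_notMem (by simpa) _ _
  -- A strongly measurable version of `V` makes the fibre integrals below measurable functions of
  -- `y`.
  obtain ⟨U, hU, hVU⟩ := hV.1
  have hUL : MemLp U 2 cubeMeasure := hV.ae_eq hVU
  have hms := measurePreserving_splice (ω : Set ℕ)ᶜ
  have hmr := measurePreserving_restrict ω
  set v : (ω → unitInterval) → ℝ :=
    fun y => ∫ t, U (splice (ω : Set ℕ)ᶜ t (extendZero ω y)) * K t ∂cubeMeasure with hv
  have hvr : ∀ x : ℕ → unitInterval, v (fun i => x i)
      = ∫ t, U (splice (ω : Set ℕ)ᶜ t x) * K t ∂cubeMeasure := fun x => by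
    refine integral_congr_ae (Eventually.of_forall fun t => ?_)
    dsimp only
    congr 2
    funext k
    by_cases hk : k ∈ ω
    · rw [splice_of_notMem (by simpa), splice_of_notMem (by simpa), extendZero_restrict x hk]
    · rw [splice_of_mem (by simpa), splice_of_mem (by simpa)]
  have hvm : StronglyMeasurable v := by
    refine StronglyMeasurable.integral_prod_right' (f := fun p : (ω → unitInterval) × _ =>
      U (splice (ω : Set ℕ)ᶜ p.2 (extendZero ω p.1)) * K p.2) ?_
    refine (hU.comp_measurable ?_).mul (hKm.comp measurable_snd).stronglyMeasurable
    exact hms.measurable.comp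
      (measurable_snd.prodMk ((continuous_extendZero ω).measurable.comp measurable_fst))
  have hnorm : eLpNorm v 2 volume
      ≤ ENNReal.ofReal (√(anchorConst a) ^ σ.card) * eLpNorm V 2 cubeMeasure := by
    have hKn : ∫⁻ x, ‖K x‖ₑ ^ 2 ∂cubeMeasure = ENNReal.ofReal (anchorConst a ^ σ.card) := by
      rw [← integral_prod_kern_sq a σ, ofReal_integral_eq_lintegral_ofReal]
      · refine lintegral_congr fun x => ?_
        rw [← ofReal_norm, ← ENNReal.ofReal_pow (norm_nonneg _), Real.norm_eq_abs, sq_abs]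
      · exact Integrable.of_bound (C := 1) (hKm.pow_const 2).aestronglyMeasurable
          (Eventually.of_forall fun x => by
            rw [norm_pow]; exact pow_le_one₀ (norm_nonneg _) (hKb x))
      · exact Eventually.of_forall fun x => sq_nonneg _
    have hq : 0 ≤ anchorConst a := by
      rw [anchorConst, ← integral_kern_sq a.2, ← integral_unitInterval (fun x => kern a x ^ 2)]
      exact integral_nonneg fun _ => sq_nonneg _
    rw [← ENNReal.pow_le_pow_left_iff two_ne_zero, mul_pow,
      ← ENNReal.ofReal_pow (by positivity), ← pow_mul, mul_comm σ.card, pow_mul, Real.sq_sqrt hq,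
      ← hKn, eLpNorm_congr_ae hVU, ← eLpNorm_comp_measurePreserving hvm.aestronglyMeasurable hmr,
      eLpNorm_two_sq, eLpNorm_two_sq]
    have h1 : ∫⁻ x, ‖(v ∘ fun (x : ℕ → unitInterval) (k : ω) => x k) x‖ₑ ^ 2 ∂cubeMeasure
        ≤ ∫⁻ x, (∫⁻ t, ‖U (splice (ω : Set ℕ)ᶜ t x)‖ₑ ^ 2 ∂cubeMeasure)
          * ∫⁻ t, ‖K t‖ₑ ^ 2 ∂cubeMeasure ∂cubeMeasure := by
      refine lintegral_mono fun x => ?_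
      rw [Function.comp_apply, hvr]
      refine enorm_integral_mul_sq_le ?_ hKm.aemeasurable
      exact (hU.measurable.comp (hms.measurable.comp
        (measurable_id.prodMk measurable_const))).aemeasurable
    refine h1.trans (le_of_eq ?_)
    have hUm : Measurable fun x => ‖U x‖ₑ ^ 2 := hU.measurable.enorm.pow_const 2
    rw [lintegral_mul_const', mul_comm]
    · congr 1
      rw [← hms.lintegral_comp hUm, lintegral_prod_symm']
      exact hUm.comp hms.measurable
    · rw [hKn]; exact ENNReal.ofReal_ne_top
  refine iInf₂_le_of_le v ⟨⟨hvm.aestronglyMeasurable, hnorm.trans_lt ?_⟩, fun φ hφ => ?_⟩ hnorm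
  · exact ENNReal.mul_lt_top ENNReal.ofReal_lt_top hV.2
  · have hc : ∀ {φ : (ω → ℝ) → ℝ}, IsTestFunction φ →
        Continuous fun y : ω → unitInterval => φ (fun k => (y k : ℝ)) := fun hφ =>
      hφ.smooth.continuous.comp (by fun_prop)
    have h1 := h.integral_eq φ hφ
    rw [subtype_mem_eq_univ] at h1
    have hUK : Integrable (fun x => U x * K x * φ (coords ω x)) cubeMeasure :=
      integrable_mul_continuous (memLp_mul_of_abs_le_one hUL hKm hKb)
        hφ.continuous_comp_coords
    rw [← MeasurePreserving.integral_comp_eq hmr, ← MeasurePreserving.integral_comp_eq hmr,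
      Finset.card_univ, Fintype.card_coe]
    · simp_rw [toCube_restrict hF, hvr]
      refine h1.trans ?_
      congr 1
      have h2 : ∫ x, V x * K x * φ (coords ω x) ∂cubeMeasure
          = ∫ x, U x * K x * φ (coords ω x) ∂cubeMeasure :=
        integral_congr_ae (by filter_upwards [hVU] with x hx; rw [hx])
      rw [h2, ← integral_splice (ω : Set ℕ)ᶜ hUK]
      congr 1
      ext x
      simp_rw [hKt, hct]
      rw [integral_mul_const]
      rfl
    · exact (hvm.aestronglyMeasurable).mul (hc hφ).aestronglyMeasurable
    · exact ((hFc.comp (continuous_extendZero ω)).mul (hc (hφ.mixedPartial _))).aestronglyMeasurable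

/-! ## Decompositions generated by commuting projectors -/

theorem splice_splice (σ τ : Set ℕ) (s t x : ℕ → unitInterval) :
    splice τ s (splice σ t x) = splice (σ ∪ τ) (splice τ s t) x := by
  funext k
  by_cases hτ : k ∈ τ <;> by_cases hσ : k ∈ σ <;> simp [splice, hτ, hσ]

theorem splice_singleton (j : ℕ) (a : unitInterval) (x : ℕ → unitInterval) :
    splice {j} (fun _ => a) x = Function.update x j a := by
  funext k
  by_cases hk : k = j
  · subst hk; simp [splice]
  · simp [splice, hk]

/-- Commuting linear projectors `Q_σ`, each of which removes the dependence on the variables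
in `σ`. -/
structure IsProjectorFamily (Q : Set ℕ → ((ℕ → unitInterval) → ℝ) → (ℕ → unitInterval) → ℝ) :
    Prop where
  continuous : ∀ σ {f}, Continuous f → Continuous (Q σ f)
  add : ∀ σ {f g}, Continuous f → Continuous g → Q σ (f + g) = Q σ f + Q σ g
  smul : ∀ σ (c : ℝ) f, Q σ (c • f) = c • Q σ f
  comp : ∀ σ τ {f}, Continuous f → Q σ (Q τ f) = Q (σ ∪ τ) f
  eq_self : ∀ {σ f}, DependsOn f σᶜ → Q σ f = f
  dependsOn : ∀ {σ s : Set ℕ} {f}, DependsOn f s → DependsOn (Q σ f) (s \ σ)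

theorem splice_congr {σ s : Set ℕ} {x y : ℕ → unitInterval} (h : ∀ k ∈ s \ σ, x k = y k)
    (t : ℕ → unitInterval) : ∀ k ∈ s, splice σ t x k = splice σ t y k := fun k hk => by
  by_cases hσ : k ∈ σ
  · rw [splice_of_mem hσ, splice_of_mem hσ]
  · rw [splice_of_notMem hσ, splice_of_notMem hσ, h k ⟨hk, hσ⟩]

theorem continuous_splice_right (σ : Set ℕ) (t : ℕ → unitInterval) :
    Continuous fun x => splice σ t x :=
  (continuous_splice σ).comp (continuous_const.prodMk continuous_id)

theorem continuous_splice_left (σ : Set ℕ) (x : ℕ → unitInterval) :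
    Continuous fun t => splice σ t x :=
  (continuous_splice σ).comp (continuous_id.prodMk continuous_const)

theorem isProjectorFamily_anchorAt (xs : unitInterval) : IsProjectorFamily (anchorAt xs) where
  continuous σ f hf := hf.comp (continuous_splice_right σ _)
  add σ f g _ _ := rfl
  smul σ c f := rfl
  comp σ τ f _ := by
    funext x
    simp only [anchorAt_apply, splice_splice]
    congr 2
    funext k
    by_cases hk : k ∈ τ <;> simp [splice, hk]
  eq_self {σ f} hf := by
    funext x
    exact hf fun k hk => splice_of_notMem hk _ _
  dependsOn {σ s f} hf x y h := hf (splice_congr h _)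

theorem isProjectorFamily_avg : IsProjectorFamily avg where
  continuous σ f hf := by
    obtain ⟨C, hC⟩ := exists_bound_of_continuous hf
    refine continuous_of_dominated (bound := fun _ => C) (fun x => ?_)
      (fun x => Eventually.of_forall fun t => hC _) (integrable_const C)
      (Eventually.of_forall fun t => hf.comp (continuous_splice_right σ t))
    exact (hf.comp (continuous_splice_left σ x)).aestronglyMeasurable
  add σ f g hf hg := by
    funext x
    exact integral_add (integrable_of_continuous (hf.comp (continuous_splice_left σ x)))
      (integrable_of_continuous (hg.comp (continuous_splice_left σ x)))
  smul σ c f := by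
    funext x
    exact integral_const_mul c _
  comp σ τ f hf := by
    funext x
    simp only [avg_apply, splice_splice]
    exact integral_splice τ (F := fun t => f (splice (σ ∪ τ) t x))
      (integrable_of_continuous (hf.comp (continuous_splice_left _ x)))
  eq_self {σ f} hf := by
    funext x
    have : ∀ t, f (splice σ t x) = f x := fun t => hf fun k hk => splice_of_notMem hk _ _
    simp [avg_apply, this]
  dependsOn {σ s f} hf x y h := by
    simp only [avg_apply]
    congr 1
    funext t
    exact hf (splice_congr h t)

theorem sum_powerset_alternating_eq_zero {ω : Finset ℕ} {j : ℕ} (hj : j ∈ ω) {G : Finset ℕ → ℝ}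
    (hG : ∀ s, G (insert j s) = G s) : ∑ s ∈ ω.powerset, (-1) ^ s.card * G s = 0 := by
  rw [← Finset.insert_erase hj, Finset.sum_powerset_insert (Finset.notMem_erase j ω),
    ← Finset.sum_add_distrib]
  refine Finset.sum_eq_zero fun s hs => ?_
  have hjs : j ∉ s := fun h => Finset.notMem_erase j ω (Finset.mem_powerset.1 hs h)
  rw [hG, Finset.card_insert_of_notMem hjs]
  ring

/-- This is the expansion of `∏_{k ∈ U} ((Id - Q_k) + Q_k)`. In the induction, the terms with `j ∉
ω` cancel those with `j ∈ s`, and what remains is the sum for `G` evaluated after deleting `j`. -/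
theorem sum_powerset_sum_alternating (U : Finset ℕ) (G : Set ℕ → ℝ) :
    ∑ ω ∈ U.powerset, ∑ s ∈ ω.powerset, (-1) ^ s.card * G (↑s ∪ (↑ω : Set ℕ)ᶜ) = G (↑U)ᶜ := by
  induction U using Finset.induction_on generalizing G with
  | empty => simp
  | insert j U hj ih =>
    rw [Finset.sum_powerset_insert hj, ← Finset.sum_add_distrib]
    have h := ih (fun A => G (A \ {j}))
    have hU : (↑(insert j U) : Set ℕ)ᶜ = (↑U : Set ℕ)ᶜ \ {j} := by
      ext k; simp [and_comm]
    rw [hU, ← h]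
    refine Finset.sum_congr rfl fun ω hω => ?_
    have hjω : j ∉ ω := fun h => hj (Finset.mem_powerset.1 hω h)
    rw [Finset.sum_powerset_insert hjω, ← Finset.sum_add_distrib, ← Finset.sum_add_distrib]
    refine Finset.sum_congr rfl fun s hs => ?_
    have hjs : j ∉ s := fun h => hjω (Finset.mem_powerset.1 hs h)
    have h1 : (↑(insert j s) : Set ℕ) ∪ (↑(insert j ω) : Set ℕ)ᶜ = ↑s ∪ (↑ω : Set ℕ)ᶜ := by
      ext k
      by_cases hk : k = j
      · subst hk; simp [hjω]
      · simp [hk]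
    have h2 : (↑s : Set ℕ) ∪ (↑(insert j ω) : Set ℕ)ᶜ = (↑s ∪ (↑ω : Set ℕ)ᶜ) \ {j} := by
      ext k
      by_cases hk : k = j
      · subst hk; simp [hjs]
      · simp [hk]
    rw [h1, h2, Finset.card_insert_of_notMem hjs]
    ring

namespace IsProjectorFamily

variable {Q : Set ℕ → ((ℕ → unitInterval) → ℝ) → (ℕ → unitInterval) → ℝ}

theorem decompTerm_apply (hQ : IsProjectorFamily Q) (ω : Finset ℕ) {f : (ℕ → unitInterval) → ℝ}
    (hf : Continuous f) (x : ℕ → unitInterval) :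
    decompTerm Q ω f x = ∑ s ∈ ω.powerset, (-1) ^ s.card * Q (↑s ∪ (↑ω : Set ℕ)ᶜ) f x := by
  simp only [decompTerm, hQ.comp _ _ hf]

theorem decompTerm_eq_sum (hQ : IsProjectorFamily Q) (ω : Finset ℕ) {f : (ℕ → unitInterval) → ℝ}
    (hf : Continuous f) :
    decompTerm Q ω f
      = ∑ s ∈ ω.powerset, ((-1 : ℝ) ^ s.card) • Q (↑s ∪ (↑ω : Set ℕ)ᶜ) f := by
  funext x
  rw [hQ.decompTerm_apply ω hf, Finset.sum_apply]
  rfl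

theorem zero (hQ : IsProjectorFamily Q) (σ : Set ℕ) : Q σ 0 = 0 := by
  simpa using hQ.smul σ 0 0

theorem sum (hQ : IsProjectorFamily Q) (σ : Set ℕ) {α : Type} (T : Finset α)
    {f : α → (ℕ → unitInterval) → ℝ} (hf : ∀ i ∈ T, Continuous (f i)) :
    Q σ (∑ i ∈ T, f i) = ∑ i ∈ T, Q σ (f i) := by
  classical
  induction T using Finset.induction_on with
  | empty => simpa using hQ.zero σ
  | insert i T hi ih =>
    rw [Finset.sum_insert hi, Finset.sum_insert hi, hQ.add σ (hf i (Finset.mem_insert_self i T))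
      (by
        rw [Finset.sum_fn]
        exact continuous_finsetSum _ fun k hk => hf k (Finset.mem_insert_of_mem hk)),
      ih fun k hk => hf k (Finset.mem_insert_of_mem hk)]

theorem continuous_decompTerm (hQ : IsProjectorFamily Q) (ω : Finset ℕ)
    {f : (ℕ → unitInterval) → ℝ} (hf : Continuous f) : Continuous (decompTerm Q ω f) :=
  continuous_finsetSum _ fun _ _ =>
    continuous_const.mul (hQ.continuous _ (hQ.continuous _ hf))

theorem dependsOn_decompTerm (hQ : IsProjectorFamily Q) (ω : Finset ℕ)
    (f : (ℕ → unitInterval) → ℝ) : DependsOn (decompTerm Q ω f) ω := fun x y h => by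
  refine Finset.sum_congr rfl fun s _ => ?_
  rw [hQ.dependsOn (hQ.dependsOn (dependsOn_univ f)) fun k hk => h k (by simpa using hk.1)]

theorem decompTerm_add (hQ : IsProjectorFamily Q) (ω : Finset ℕ) {f g : (ℕ → unitInterval) → ℝ}
    (hf : Continuous f) (hg : Continuous g) :
    decompTerm Q ω (f + g) = decompTerm Q ω f + decompTerm Q ω g := by
  funext x
  simp only [Pi.add_apply, hQ.decompTerm_apply ω hf, hQ.decompTerm_apply ω hg,
    hQ.decompTerm_apply ω (hf.add hg), ← Finset.sum_add_distrib, hQ.add _ hf hg, mul_add]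

theorem decompTerm_zero (hQ : IsProjectorFamily Q) (ω : Finset ℕ) : decompTerm Q ω 0 = 0 := by
  funext x
  simp [decompTerm, hQ.zero]

theorem decompTerm_sum (hQ : IsProjectorFamily Q) (ω : Finset ℕ) {α : Type} (T : Finset α)
    {f : α → (ℕ → unitInterval) → ℝ} (hf : ∀ i ∈ T, Continuous (f i)) :
    decompTerm Q ω (∑ i ∈ T, f i) = ∑ i ∈ T, decompTerm Q ω (f i) := by
  classical
  induction T using Finset.induction_on with
  | empty => simpa using hQ.decompTerm_zero ω
  | insert i T hi ih =>
    rw [Finset.sum_insert hi, Finset.sum_insert hi,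
      hQ.decompTerm_add ω (hf i (Finset.mem_insert_self i T))
      (by
        rw [Finset.sum_fn]
        exact continuous_finsetSum _ fun k hk => hf k (Finset.mem_insert_of_mem hk)),
      ih fun k hk => hf k (Finset.mem_insert_of_mem hk)]

/-- If `j ∈ ω \ η`, applying `Q {j}` changes nothing, so the summands for `s` and `insert j s`
cancel. -/
theorem decompTerm_eq_zero (hQ : IsProjectorFamily Q) {ω η : Finset ℕ} (h : ¬ω ⊆ η)
    {f : (ℕ → unitInterval) → ℝ} (hf : Continuous f) (hfη : DependsOn f η) :
    decompTerm Q ω f = 0 := by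
  obtain ⟨j, hj, hjη⟩ := Finset.not_subset.1 h
  funext x
  rw [hQ.decompTerm_apply ω hf]
  refine sum_powerset_alternating_eq_zero hj (G := fun s => Q (↑s ∪ (↑ω : Set ℕ)ᶜ) f x) fun s => ?_
  have h1 : Q {j} f = f := hQ.eq_self (hfη.mono fun k hk => by
    rintro rfl; exact hjη hk)
  have h2 : (↑(insert j s) : Set ℕ) ∪ (↑ω : Set ℕ)ᶜ = (↑s ∪ (↑ω : Set ℕ)ᶜ) ∪ {j} := by
    ext k; simp; tauto
  rw [h2, ← hQ.comp _ _ hf, h1]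

/-- Again `s` and `insert j s` cancel. This annihilation is what lets the kernel identity be used
without boundary terms. -/
theorem apply_singleton_decompTerm (hQ : IsProjectorFamily Q) {ω : Finset ℕ} {j : ℕ} (hj : j ∈ ω)
    {f : (ℕ → unitInterval) → ℝ} (hf : Continuous f) : Q {j} (decompTerm Q ω f) = 0 := by
  rw [hQ.decompTerm_eq_sum ω hf,
    hQ.sum _ _ fun s _ => (hQ.continuous _ hf).const_smul ((-1 : ℝ) ^ s.card)]
  funext x
  rw [Finset.sum_apply]
  have : ∀ s : Finset ℕ, Q {j} (((-1 : ℝ) ^ s.card) • Q (↑s ∪ (↑ω : Set ℕ)ᶜ) f) x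
      = (-1) ^ s.card * Q ({j} ∪ (↑s ∪ (↑ω : Set ℕ)ᶜ)) f x := fun s => by
    rw [hQ.smul, hQ.comp _ _ hf]
    rfl
  simp only [this]
  refine sum_powerset_alternating_eq_zero hj
    (G := fun s => Q ({j} ∪ (↑s ∪ (↑ω : Set ℕ)ᶜ)) f x) fun s => ?_
  rw [show ({j} : Set ℕ) ∪ (↑(insert j s) ∪ (↑ω : Set ℕ)ᶜ) = {j} ∪ (↑s ∪ (↑ω : Set ℕ)ᶜ) by
    ext k; simp; tauto]

theorem sum_decompTerm (hQ : IsProjectorFamily Q) {U : Finset ℕ} {f : (ℕ → unitInterval) → ℝ}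
    (hf : Continuous f) (hfU : DependsOn f U) : ∑ ω ∈ U.powerset, decompTerm Q ω f = f := by
  funext x
  rw [Finset.sum_apply]
  simp only [hQ.decompTerm_apply _ hf]
  rw [sum_powerset_sum_alternating U (fun A => Q A f x), hQ.eq_self (by rwa [compl_compl])]

end IsProjectorFamily

/-! ## Norms of the terms of the decompositions -/

/-- `q = (x* - 1/2) ^ 2 + 1/12`. -/
theorem anchorConst_pos (xs : unitInterval) : 0 < anchorConst xs := by
  unfold anchorConst
  nlinarith [sq_nonneg ((xs : ℝ) - 1 / 2)]

section Cube

variable {ι : Type} [Fintype ι]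

theorem integrable_mul_mixedPartial {g : (ι → unitInterval) → ℝ} (hg : Continuous g)
    {φ : (ι → ℝ) → ℝ} (hφ : IsTestFunction φ) (S : Finset ι) :
    Integrable fun x : ι → unitInterval => g x * mixedPartial S φ (fun k => (x k : ℝ)) :=
  integrable_of_continuous
    (hg.mul ((hφ.mixedPartial S).smooth.continuous.comp (by fun_prop)))

theorem integrable_mul_test {v : (ι → unitInterval) → ℝ} (hv : MemLp v 2 volume)
    {φ : (ι → ℝ) → ℝ} (hφ : IsTestFunction φ) :
    Integrable fun x : ι → unitInterval => v x * φ (fun k => (x k : ℝ)) := by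
  have hc : Continuous fun x : ι → unitInterval => φ (fun k => (x k : ℝ)) :=
    hφ.smooth.continuous.comp (by fun_prop)
  obtain ⟨C, hC⟩ := exists_bound_of_continuous hc
  exact (hv.integrable one_le_two).mul_bdd hc.aestronglyMeasurable (Eventually.of_forall hC)

theorem IsWeakMixedDeriv.add {S : Finset ι} {g g' v v' : (ι → unitInterval) → ℝ}
    (hg : Continuous g) (hg' : Continuous g') (h : IsWeakMixedDeriv S g v)
    (h' : IsWeakMixedDeriv S g' v') : IsWeakMixedDeriv S (g + g') (v + v') := by
  refine ⟨h.1.add h'.1, fun φ hφ => ?_⟩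
  simp only [Pi.add_apply, add_mul]
  rw [integral_add (integrable_mul_mixedPartial hg hφ S) (integrable_mul_mixedPartial hg' hφ S),
    integral_add (integrable_mul_test h.1 hφ) (integrable_mul_test h'.1 hφ), h.2 φ hφ, h'.2 φ hφ,
    mul_add]

theorem IsWeakMixedDeriv.neg {S : Finset ι} {g v : (ι → unitInterval) → ℝ}
    (h : IsWeakMixedDeriv S g v) : IsWeakMixedDeriv S (-g) (-v) := by
  refine ⟨h.1.neg, fun φ hφ => ?_⟩
  simp only [Pi.neg_apply, neg_mul, integral_neg, h.2 φ hφ, mul_neg]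

theorem isWeakMixedDeriv_zero (S : Finset ι) : IsWeakMixedDeriv S 0 0 :=
  ⟨MemLp.zero, fun φ _ => by simp⟩

theorem mixedDerivNorm_zero : mixedDerivNorm (0 : (ι → unitInterval) → ℝ) = 0 :=
  le_antisymm (iInf₂_le_of_le 0 (isWeakMixedDeriv_zero _) (by simp)) zero_le

theorem mixedDerivNorm_add_le {g g' : (ι → unitInterval) → ℝ} (hg : Continuous g)
    (hg' : Continuous g') : mixedDerivNorm (g + g') ≤ mixedDerivNorm g + mixedDerivNorm g' := by
  conv_rhs => simp only [mixedDerivNorm, ENNReal.iInf_add, ENNReal.add_iInf]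
  refine le_iInf fun v' => le_iInf fun hv' => le_iInf fun v => le_iInf fun hv => ?_
  exact iInf₂_le_of_le (v + v') (hv.add hg hg' hv') (eLpNorm_add_le hv.1.1 hv'.1.1 one_le_two)

theorem mixedDerivNorm_sum_le {α : Type} (T : Finset α) {g : α → (ι → unitInterval) → ℝ}
    (hg : ∀ i ∈ T, Continuous (g i)) :
    mixedDerivNorm (∑ i ∈ T, g i) ≤ ∑ i ∈ T, mixedDerivNorm (g i) := by
  classical
  induction T using Finset.induction_on with
  | empty => simp [mixedDerivNorm_zero]
  | insert i T hi ih =>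
    rw [Finset.sum_insert hi, Finset.sum_insert hi]
    have hT : ∀ i ∈ T, Continuous (g i) := fun k hk => hg k (Finset.mem_insert_of_mem hk)
    refine (mixedDerivNorm_add_le (hg i (Finset.mem_insert_self i T)) ?_).trans
      (add_le_add le_rfl (ih hT))
    rw [Finset.sum_fn]
    exact continuous_finsetSum _ hT

end Cube

theorem continuous_toCube (ω : Finset ℕ) {F : (ℕ → unitInterval) → ℝ} (hF : Continuous F) :
    Continuous (toCube ω F) :=
  hF.comp (continuous_extendZero ω)

theorem toCube_sum (ω : Finset ℕ) {α : Type} (T : Finset α) (F : α → (ℕ → unitInterval) → ℝ) :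
    toCube ω (∑ i ∈ T, F i) = ∑ i ∈ T, toCube ω (F i) := by
  funext y
  simp [toCube_apply]

theorem HasCylWeakDeriv.congr {ω S : Finset ℕ} {F G V : (ℕ → unitInterval) → ℝ}
    (h : HasCylWeakDeriv ω S F V) (hFG : ∀ φ : (ω → ℝ) → ℝ, IsTestFunction φ →
      ∫ x, G x * mixedPartial (S.subtype (· ∈ ω)) φ (coords ω x) ∂cubeMeasure
        = ∫ x, F x * mixedPartial (S.subtype (· ∈ ω)) φ (coords ω x) ∂cubeMeasure) :
    HasCylWeakDeriv ω S G V :=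
  ⟨h.memLp, fun φ hφ => (hFG φ hφ).trans (h.integral_eq φ hφ)⟩

theorem integral_avg_mul (σ : Set ℕ) {F G : (ℕ → unitInterval) → ℝ} (hF : Continuous F)
    (hG : Continuous G) (hGσ : ∀ t x, G (splice σ t x) = G x) :
    ∫ x, avg σ F x * G x ∂cubeMeasure = ∫ x, F x * G x ∂cubeMeasure := by
  have hi : Integrable (fun x => F x * G x) cubeMeasure :=
    integrable_of_continuous (hF.mul hG)
  rw [← integral_splice σ hi]
  congr 1
  ext x
  simp_rw [hGσ]
  rw [integral_mul_const, avg_apply]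

/-- Averaging over the variables outside `ω` is invisible to functions of the variables in `ω`. -/
theorem HasCylWeakDeriv.avg_compl {ω S : Finset ℕ} {F V : (ℕ → unitInterval) → ℝ}
    (hF : Continuous F) (h : HasCylWeakDeriv ω S F V) :
    HasCylWeakDeriv ω S (avg (ω : Set ℕ)ᶜ F) V :=
  h.congr fun φ hφ => integral_avg_mul _ hF (hφ.mixedPartial _).continuous_comp_coords
    fun t x => by rw [coords_congr fun k hk => splice_of_notMem (by simpa) t x]

/-- Only the summand `s = ∅` survives testing: every other one is independent of some variable in `s
⊆ ω`. -/
theorem HasCylWeakDeriv.decompTerm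
    {Q : Set ℕ → ((ℕ → unitInterval) → ℝ) → (ℕ → unitInterval) → ℝ} (hQ : IsProjectorFamily Q)
    {ω : Finset ℕ} {F V : (ℕ → unitInterval) → ℝ} (hF : Continuous F)
    (h : HasCylWeakDeriv ω ω (Q (ω : Set ℕ)ᶜ F) V) :
    HasCylWeakDeriv ω ω (decompTerm Q ω F) V := by
  refine h.congr fun φ hφ => ?_
  have hF' := hQ.continuous (ω : Set ℕ)ᶜ hF
  have hd := (hφ.mixedPartial (ω.subtype (· ∈ ω))).continuous_comp_coords
  have hi : ∀ s ∈ ω.powerset, Integrable (fun x => (-1) ^ s.card * (Q s (Q (ω : Set ℕ)ᶜ F) x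
      * mixedPartial (ω.subtype (· ∈ ω)) φ (coords ω x))) cubeMeasure := fun s _ =>
    (integrable_of_continuous ((hQ.continuous s hF').mul hd)).const_mul _
  simp only [AnovaAnchored.decompTerm, Finset.sum_mul, mul_assoc]
  rw [integral_finsetSum _ hi, Finset.sum_eq_single_of_mem ∅ (by simp)]
  · simp only [Finset.card_empty, pow_zero, one_mul, Finset.coe_empty]
    rw [hQ.eq_self (by simpa using dependsOn_univ _)]
  · intro s hs hs0
    obtain ⟨j, hj⟩ := Finset.nonempty_iff_ne_empty.2 hs0
    rw [integral_const_mul, integral_mul_mixedPartial_eq_zero (Finset.mem_powerset.1 hs hj)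
      (hQ.continuous _ hF') (fun x t => ?_) hφ, mul_zero]
    refine hQ.dependsOn (dependsOn_univ _) fun k hk => ?_
    rw [Function.update_of_ne]
    rintro rfl
    exact hk.2 hj

theorem HasCylWeakDeriv.of_union {ω σ : Finset ℕ} {F V : (ℕ → unitInterval) → ℝ}
    (hF : Continuous F) (hσ : Disjoint σ ω) (h : HasCylWeakDeriv (σ ∪ ω) ω F V) :
    HasCylWeakDeriv ω ω F V := by
  induction σ using Finset.induction_on with
  | empty => simpa using h
  | insert j σ hj ih =>
    rw [Finset.disjoint_insert_left] at hσ
    rw [Finset.insert_union] at h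
    exact ih hσ.2 (h.of_insert (by simp [hj, hσ.1]) Finset.subset_union_right hF)

/-- Each step of `sub_update` subtracts an anchored value, which is zero by assumption, so `F`
itself is kept and only kernels accumulate. -/
theorem HasCylWeakDeriv.of_anchored {ω σ : Finset ℕ} {a : unitInterval}
    {F V : (ℕ → unitInterval) → ℝ} (hF : Continuous F) (hσ : Disjoint σ ω)
    (ha : ∀ j ∈ σ, anchorAt a {j} F = 0) (h : HasCylWeakDeriv (σ ∪ ω) (σ ∪ ω) F V) :
    HasCylWeakDeriv ω ω F (fun x => V x * ∏ k ∈ σ, kern a (x k)) := by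
  induction σ using Finset.induction_on generalizing V with
  | empty => simpa using h
  | insert j σ hj ih =>
    rw [Finset.disjoint_insert_left] at hσ
    rw [Finset.insert_union] at h
    have h1 := h.sub_update (by simp [hj, hσ.1]) subset_rfl hF a
    have h2 : ∀ x, F (Function.update x j a) = 0 := fun x => by
      rw [← splice_singleton]
      exact congrFun (ha j (Finset.mem_insert_self j σ)) x
    simp only [h2, sub_zero] at h1
    have h3 := ih hσ.2 (fun k hk => ha k (Finset.mem_insert_of_mem hk)) h1
    simpa only [Finset.prod_insert hj, mul_assoc] using h3

theorem anchorAt_avg_comm {i j : ℕ} (hij : i ≠ j) (a : unitInterval)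
    (F : (ℕ → unitInterval) → ℝ) : avg {i} (anchorAt a {j} F) = anchorAt a {j} (avg {i} F) := by
  funext x
  simp only [avg_apply, anchorAt_apply]
  congr 1
  funext t
  congr 1
  funext k
  by_cases hi : k = i
  · subst hi; simp [splice, hij]
  · by_cases hj : k = j
    · subst hj; simp [splice, hi]
    · simp [splice, hi, hj]

/-- Here it is `F` that drops out of `F - F(x_j = a)`: its mean in `x_j` is zero and the test
function does not involve `x_j`. The anchored function remains, with one sign per variable. -/
theorem HasCylWeakDeriv.of_avg_eq_zero {ω σ : Finset ℕ} (a : unitInterval)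
    {F V : (ℕ → unitInterval) → ℝ} (hF : Continuous F) (hσ : Disjoint σ ω)
    (ha : ∀ j ∈ σ, avg {j} F = 0) (h : HasCylWeakDeriv (σ ∪ ω) (σ ∪ ω) F V) :
    HasCylWeakDeriv ω ω (anchorAt a σ F)
      (fun x => ((-1) ^ σ.card * V x) * ∏ k ∈ σ, kern a (x k)) := by
  induction σ using Finset.induction_on generalizing F V with
  | empty =>
    have : anchorAt a ((∅ : Finset ℕ) : Set ℕ) F = F :=
      (isProjectorFamily_anchorAt a).eq_self (by simpa using dependsOn_univ _)
    rw [this]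
    simpa using h
  | insert j σ hj ih =>
    have hP := isProjectorFamily_anchorAt a
    rw [Finset.disjoint_insert_left] at hσ
    rw [Finset.insert_union] at h
    have hjω : j ∉ σ ∪ ω := by simp [hj, hσ.1]
    have h1 := h.sub_update hjω subset_rfl hF a
    have hFj := hP.continuous {j} hF
    have h2 : HasCylWeakDeriv (σ ∪ ω) (σ ∪ ω) (anchorAt a {j} F)
        (fun x => -(V x * kern a (x j))) := by
      refine ⟨h1.memLp.neg, fun φ hφ => ?_⟩
      have hd := (hφ.mixedPartial ((σ ∪ ω).subtype (· ∈ σ ∪ ω))).continuous_comp_coords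
      have h3 := h1.integral_eq φ hφ
      have h4 := integral_avg_mul {j} hF hd fun t x => by
        rw [coords_congr fun k hk => splice_of_notMem (σ := {j}) (fun h => hjω (by
          rw [Set.mem_singleton_iff] at h; exact h ▸ hk)) t x]
      simp only [ha j (Finset.mem_insert_self j σ), Pi.zero_apply, zero_mul, integral_zero] at h4
      have h5 := integral_sub (integrable_of_continuous (μ := cubeMeasure) (hF.mul hd))
        (integrable_of_continuous (hFj.mul hd))
      simp only [Pi.mul_apply, ← sub_mul] at h5
      rw [← h4, zero_sub] at h5
      simp only [← splice_singleton] at h3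
      change ∫ x, (F x - anchorAt a {j} F x) * _ ∂cubeMeasure = _ at h3
      rw [h5] at h3
      simp only [neg_mul, integral_neg, mul_neg]
      linarith
    -- Anchoring `x_j` commutes with averaging over another variable, so the vanishing averages
    -- persist.
    have h3 := ih hFj hσ.2 (fun k hk => by
      rw [anchorAt_avg_comm (by rintro rfl; exact hj hk), ha k (Finset.mem_insert_of_mem hk),
        hP.zero]) h2
    have h4 : (↑(insert j σ) : Set ℕ) = ↑σ ∪ {j} := by
      ext k; simp
    rw [hP.comp _ _ hF, ← h4] at h3
    convert h3 using 2
    rw [Finset.prod_insert hj, Finset.card_insert_of_notMem hj]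
    ring

/-- The terms of the decomposition generated by `Q` of a function of the variables in `η` which is
annihilated by `R_j` for all `j ∈ η` are bounded by the norm of that function. -/
def TermBound (Q R : Set ℕ → ((ℕ → unitInterval) → ℝ) → (ℕ → unitInterval) → ℝ) (q : ℝ) : Prop :=
  ∀ {ω η : Finset ℕ}, ω ⊆ η → ∀ {F : (ℕ → unitInterval) → ℝ}, Continuous F → DependsOn F η →
    (∀ j ∈ η, R {j} F = 0) →
    mixedDerivNorm (toCube ω (decompTerm Q ω F))
      ≤ ENNReal.ofReal (√q ^ (η \ ω).card) * mixedDerivNorm (toCube η F)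

/-- Reduces a bound by the infimum to one for each weak derivative, so its uniqueness is never
needed. Positivity of `c` covers the case of no weak derivative, where the norm is `∞`. -/
theorem le_mul_mixedDerivNorm {ι : Type} [Fintype ι] {g : (ι → unitInterval) → ℝ} {c : ℝ}
    (hc : 0 < c) {b : ℝ≥0∞}
    (h : ∀ v, IsWeakMixedDeriv Finset.univ g v → b ≤ ENNReal.ofReal c * eLpNorm v 2 volume) :
    b ≤ ENNReal.ofReal c * mixedDerivNorm g := by
  have h0 : ENNReal.ofReal c ≠ 0 := by simpa using hc
  rw [mixedDerivNorm, ENNReal.mul_iInf_of_ne h0 ENNReal.ofReal_ne_top]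
  refine le_iInf fun v => ?_
  rw [ENNReal.mul_iInf_of_ne h0 ENNReal.ofReal_ne_top]
  exact le_iInf fun hv => h v hv

theorem termBound_avg_anchorAt (a : unitInterval) :
    TermBound avg (anchorAt a) (anchorConst a) := by
  intro ω η hωη F hF hFη ha
  have hq := Real.sqrt_pos.2 (anchorConst_pos a)
  refine le_mul_mixedDerivNorm (by positivity) fun v hv => ?_
  rw [← subtype_mem_eq_univ] at hv
  have h1 := hv.hasCylWeakDeriv hF hFη subset_rfl
  nth_rewrite 1 2 [← Finset.sdiff_union_of_subset hωη] at h1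
  have h2 := h1.of_anchored hF Finset.sdiff_disjoint
    fun j hj => ha j (Finset.sdiff_subset hj)
  have h3 := (h2.avg_compl hF).decompTerm isProjectorFamily_avg hF
  have hm := measurePreserving_restrict η
  have h4 := h3.mixedDerivNorm_le Finset.sdiff_disjoint a
    (isProjectorFamily_avg.continuous_decompTerm ω hF)
    (isProjectorFamily_avg.dependsOn_decompTerm ω F) (hv.1.comp_measurePreserving hm)
  rwa [← eLpNorm_comp_measurePreserving hv.1.1 hm]

theorem termBound_anchorAt_avg (a : unitInterval) :
    TermBound (anchorAt a) avg (anchorConst a) := by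
  intro ω η hωη F hF hFη ha
  have hP := isProjectorFamily_anchorAt a
  have hq := Real.sqrt_pos.2 (anchorConst_pos a)
  refine le_mul_mixedDerivNorm (by positivity) fun v hv => ?_
  rw [← subtype_mem_eq_univ] at hv
  have h1 := hv.hasCylWeakDeriv hF hFη subset_rfl
  nth_rewrite 1 2 [← Finset.sdiff_union_of_subset hωη] at h1
  have h2 := h1.of_avg_eq_zero a hF Finset.sdiff_disjoint
    fun j hj => ha j (Finset.sdiff_subset hj)
  -- `F` depends only on `η`, so anchoring all of `ωᶜ` amounts to anchoring the finite set `η \ ω`.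
  have hc : anchorAt a (ω : Set ℕ)ᶜ F = anchorAt a ((η \ ω : Finset ℕ) : Set ℕ) F := by
    funext x
    simp only [anchorAt_apply]
    refine hFη fun k hk => ?_
    by_cases hω : k ∈ ω
    · rw [splice_of_notMem (by simpa), splice_of_notMem (by simp [hω])]
    · rw [splice_of_mem (by simpa), splice_of_mem (by simpa using ⟨hk, hω⟩)]
  rw [← hc] at h2
  have h3 := h2.decompTerm hP hF
  have hm := measurePreserving_restrict η
  have hV := hv.1.comp_measurePreserving hm
  have h4 := h3.mixedDerivNorm_le Finset.sdiff_disjoint a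
    (hP.continuous_decompTerm ω hF) (hP.dependsOn_decompTerm ω F) (hV.const_mul _)
  rw [← eLpNorm_comp_measurePreserving hv.1.1 hm]
  refine h4.trans (le_of_eq ?_)
  congr 1
  refine eLpNorm_congr_norm_ae (Eventually.of_forall fun x => ?_)
  simp

/-- Expand `f` into its `R`-terms and take the `Q`-term of each: those with `ω ⊄ η` vanish, and
`hQR` bounds the others because `R {j}` annihilates the `η`-term for `j ∈ η`. -/
theorem mixedDerivNorm_decompTerm_le
    {Q R : Set ℕ → ((ℕ → unitInterval) → ℝ) → (ℕ → unitInterval) → ℝ} (hQ : IsProjectorFamily Q)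
    (hR : IsProjectorFamily R) {q : ℝ} (hQR : TermBound Q R q) {D : Finset (Finset ℕ)}
    {f : (ℕ → unitInterval) → ℝ} (hf : Continuous f) (hfD : ∑ η ∈ D, decompTerm R η f = f)
    (ω : Finset ℕ) :
    mixedDerivNorm (toCube ω (decompTerm Q ω f))
      ≤ ∑ η ∈ D with ω ⊆ η, ENNReal.ofReal (√q ^ (η \ ω).card)
        * mixedDerivNorm (toCube η (decompTerm R η f)) := by
  have hc : ∀ η, Continuous (decompTerm R η f) := fun η => hR.continuous_decompTerm η hf
  have h1 : decompTerm Q ω f = ∑ η ∈ D with ω ⊆ η, decompTerm Q ω (decompTerm R η f) := by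
    conv_lhs => rw [← hfD]
    rw [hQ.decompTerm_sum ω D fun η _ => hc η, Finset.sum_filter]
    refine Finset.sum_congr rfl fun η _ => ?_
    split_ifs with h
    · rfl
    · exact hQ.decompTerm_eq_zero h (hc η) (hR.dependsOn_decompTerm η f)
  rw [h1, toCube_sum]
  refine (mixedDerivNorm_sum_le _ fun η _ =>
    continuous_toCube ω (hQ.continuous_decompTerm ω (hc η))).trans
    (Finset.sum_le_sum fun η hη => ?_)
  exact hQR (Finset.mem_filter.1 hη).2 (hc η) (hR.dependsOn_decompTerm η f)
    fun j hj => hR.apply_singleton_decompTerm hj hf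

/-! ## Finite sums -/

theorem dependsOn_restrict {η : Finset ℕ} (g : (η → unitInterval) → ℝ) :
    DependsOn (fun x : ℕ → unitInterval => g fun k => x k) η := fun x y h => by
  have : (fun k : η => x k) = fun k : η => y k := funext fun k => h k k.2
  simp only [this]

theorem toCube_comp_restrict {η : Finset ℕ} (g : (η → unitInterval) → ℝ) :
    toCube η (fun x : ℕ → unitInterval => g fun k => x k) = g := by
  funext y
  simp [toCube_apply, extendZero]

/-- For averages, `∂^ω g` alone suffices: no kernel is needed, so the norm bound is used with `σ =
∅` and an arbitrary anchor. -/
theorem mixedDerivNorm_decompTerm_avg_lt_top {η : Finset ℕ} {g : (η → unitInterval) → ℝ}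
    (hg : IsMixedH1 g) (ω : Finset ℕ) :
    mixedDerivNorm (toCube ω (decompTerm avg ω fun x : ℕ → unitInterval => g fun k => x k)) < ⊤ := by
  have hF : Continuous fun x : ℕ → unitInterval => g fun k => x k :=
    hg.continuous.comp (by fun_prop)
  have hQ := isProjectorFamily_avg
  by_cases hωη : ω ⊆ η
  · obtain ⟨v, hv⟩ := hg.deriv (ω.subtype (· ∈ η))
    rw [← toCube_comp_restrict g] at hv
    have h1 := hv.hasCylWeakDeriv hF (dependsOn_restrict g) hωη
    nth_rewrite 1 [← Finset.sdiff_union_of_subset hωη] at h1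
    have h2 := ((h1.of_union hF Finset.sdiff_disjoint).avg_compl hF).decompTerm hQ hF
    refine (HasCylWeakDeriv.mixedDerivNorm_le (σ := ∅) (by simp) 0
      (hQ.continuous_decompTerm ω hF) (hQ.dependsOn_decompTerm ω _) h2.memLp
      (by simpa using h2)).trans_lt ?_
    exact ENNReal.mul_lt_top ENNReal.ofReal_lt_top h2.memLp.2
  · rw [hQ.decompTerm_eq_zero hωη hF (dependsOn_restrict g)]
    exact (mixedDerivNorm_zero (ι := ω)).trans_lt ENNReal.zero_lt_top

theorem continuous_of_mem_finiteSums {γ : Finset ℕ → ℝ} {f : (ℕ → unitInterval) → ℝ}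
    (hf : f ∈ finiteSums γ) : Continuous f := by
  obtain ⟨T, g, hg, hfg⟩ := hf
  rw [show f = fun x => ∑ ω ∈ T, g ω fun k => x k from funext hfg]
  exact continuous_finsetSum _ fun ω hω => (hg ω hω).2.continuous.comp (by fun_prop)

theorem mixedDerivNorm_avg_lt_top {γ : Finset ℕ → ℝ} {f : (ℕ → unitInterval) → ℝ}
    (hf : f ∈ finiteSums γ) (ω : Finset ℕ) :
    mixedDerivNorm (toCube ω (decompTerm avg ω f)) < ⊤ := by
  obtain ⟨T, g, hg, hfg⟩ := hf
  have hc : ∀ η ∈ T, Continuous fun x : ℕ → unitInterval => g η fun k => x k := fun η hη =>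
    (hg η hη).2.continuous.comp (by fun_prop)
  have h1 : f = ∑ η ∈ T, fun x : ℕ → unitInterval => g η fun k => x k := by
    funext x
    rw [hfg, Finset.sum_apply]
  rw [h1, isProjectorFamily_avg.decompTerm_sum ω T hc, toCube_sum]
  refine (mixedDerivNorm_sum_le _ fun η hη => continuous_toCube ω
    (isProjectorFamily_avg.continuous_decompTerm ω (hc η hη))).trans_lt ?_
  exact ENNReal.sum_lt_top.2 fun η hη => mixedDerivNorm_decompTerm_avg_lt_top (hg η hη).2 ω

/-- `D` consists of all subsets of the index sets in the given sum; it lies in the support of `γ` by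
monotonicity and serves every projector family at once, so both norms become sums over the same
finite set. -/
theorem exists_support_of_mem_finiteSums {γ : Finset ℕ → ℝ} (hγ : IsMonotoneWeight γ)
    {f : (ℕ → unitInterval) → ℝ} (hf : f ∈ finiteSums γ) :
    ∃ D : Finset (Finset ℕ), (∀ η ∈ D, η ∈ weightSupport γ) ∧
      ∀ Q, IsProjectorFamily Q →
        (∀ ω ∉ D, decompTerm Q ω f = 0) ∧ ∑ η ∈ D, decompTerm Q η f = f := by
  classical
  have hfc := continuous_of_mem_finiteSums hf
  obtain ⟨T, g, hg, hfg⟩ := hf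
  have hc : ∀ η ∈ T, Continuous fun x : ℕ → unitInterval => g η fun k => x k := fun η hη =>
    (hg η hη).2.continuous.comp (by fun_prop)
  have h1 : f = ∑ η ∈ T, fun x : ℕ → unitInterval => g η fun k => x k := by
    funext x
    rw [hfg, Finset.sum_apply]
  have hU : DependsOn f (T.biUnion id : Finset ℕ) := fun x y h => by
    rw [hfg, hfg]
    refine Finset.sum_congr rfl fun η hη => dependsOn_restrict (g η) fun k hk => h k ?_
    exact Finset.mem_biUnion.2 ⟨η, hη, hk⟩
  refine ⟨T.biUnion Finset.powerset, fun η hη => ?_, fun Q hQ => ?_⟩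
  · obtain ⟨ω, hω, hηω⟩ := Finset.mem_biUnion.1 hη
    exact hγ.monotone ω (hg ω hω).1 η (Finset.mem_powerset.1 hηω)
  · have h0 : ∀ ω ∉ T.biUnion Finset.powerset, decompTerm Q ω f = 0 := fun ω hω => by
      rw [h1, hQ.decompTerm_sum ω T hc]
      refine Finset.sum_eq_zero fun η hη =>
        hQ.decompTerm_eq_zero (fun h => hω ?_) (hc η hη) (dependsOn_restrict (g η))
      exact Finset.mem_biUnion.2 ⟨η, hη, Finset.mem_powerset.2 h⟩
    refine ⟨h0, ?_⟩
    conv_rhs => rw [← hQ.sum_decompTerm hfc hU]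
    refine Finset.sum_subset (fun ω hω => ?_) fun ω _ hω => h0 ω hω
    obtain ⟨η, hη, hωη⟩ := Finset.mem_biUnion.1 hω
    exact Finset.mem_powerset.2 ((Finset.mem_powerset.1 hωη).trans
      (Finset.subset_biUnion_of_mem id hη))

theorem sub_mem_finiteSums {γ : Finset ℕ → ℝ} {f f' : (ℕ → unitInterval) → ℝ}
    (hf : f ∈ finiteSums γ) (hf' : f' ∈ finiteSums γ) : f - f' ∈ finiteSums γ := by
  classical
  obtain ⟨T, g, hg, hfg⟩ := hf
  obtain ⟨T', g', hg', hfg'⟩ := hf'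
  have h0 : ∀ {η : Finset ℕ}, IsMixedH1 (0 : (η → unitInterval) → ℝ) := fun {η} =>
    ⟨continuous_const, fun S => ⟨0, isWeakMixedDeriv_zero S⟩⟩
  refine ⟨T ∪ T', fun ω => (if ω ∈ T then g ω else 0) - (if ω ∈ T' then g' ω else 0),
    fun ω hω => ⟨?_, ?_⟩, fun x => ?_⟩
  · rcases Finset.mem_union.1 hω with h | h
    · exact (hg ω h).1
    · exact (hg' ω h).1
  · have h1 : IsMixedH1 (if ω ∈ T then g ω else 0) := by
      split_ifs with h
      · exact (hg ω h).2
      · exact h0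
    have h2 : IsMixedH1 (if ω ∈ T' then g' ω else 0) := by
      split_ifs with h
      · exact (hg' ω h).2
      · exact h0
    refine ⟨h1.continuous.sub h2.continuous, fun S => ?_⟩
    obtain ⟨v, hv⟩ := h1.deriv S
    obtain ⟨v', hv'⟩ := h2.deriv S
    simp only [sub_eq_add_neg]
    exact ⟨v + -v', hv.add h1.continuous h2.continuous.neg hv'.neg⟩
  · simp only [Pi.sub_apply, hfg, hfg', Finset.sum_sub_distrib]
    congr 1
    · rw [← Finset.sum_subset (Finset.subset_union_left (s₁ := T) (s₂ := T'))]
      · exact Finset.sum_congr rfl fun ω hω => by simp [hω]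
      · intro ω _ hω
        simp [hω]
    · rw [← Finset.sum_subset (Finset.subset_union_right (s₁ := T) (s₂ := T'))]
      · exact Finset.sum_congr rfl fun ω hω => by simp [hω]
      · intro ω _ hω
        simp [hω]

/-! ## The weighted norms -/

theorem sum_inv_mul_sq_le {D : Finset (Finset ℕ)} {γ α a b : Finset ℕ → ℝ} {q C' C'' : ℝ}
    (hq : 0 < q) (hC' : 0 ≤ C') (hγ : ∀ ω ∈ D, 0 < γ ω) (hα : ∀ ω ∈ D, 0 < α ω)
    (ha : ∀ ω ∈ D, 0 ≤ a ω)
    (hsup : ∀ ω ∈ D, ∑ η ∈ D with ω ⊆ η, q ^ η.card * α η ≤ C' * (q ^ ω.card * α ω))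
    (hsub : ∀ η ∈ D, ∑ ω ∈ D with ω ⊆ η, α ω / γ ω ≤ C'' * (α η / γ η))
    (hab : ∀ ω ∈ D, a ω ≤ ∑ η ∈ D with ω ⊆ η, √q ^ (η \ ω).card * b η) :
    ∑ ω ∈ D, (γ ω)⁻¹ * a ω ^ 2 ≤ C' * C'' * ∑ ω ∈ D, (γ ω)⁻¹ * b ω ^ 2 := by
  have h1 : ∀ ω ∈ D, a ω ^ 2 ≤ C' * α ω * ∑ η ∈ D with ω ⊆ η, b η ^ 2 / α η := fun ω hω => by
    have hf : ∑ η ∈ D with ω ⊆ η, q ^ (η \ ω).card * α η ≤ C' * α ω := by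
      have h2 : ∀ η ∈ D.filter (ω ⊆ ·), q ^ η.card * α η
          = q ^ ω.card * (q ^ (η \ ω).card * α η) := fun η hη => by
        rw [← Finset.card_sdiff_add_card_eq_card (Finset.mem_filter.1 hη).2, pow_add]
        ring
      have h3 := hsup ω hω
      rw [Finset.sum_congr rfl h2, ← Finset.mul_sum, mul_left_comm] at h3
      exact le_of_mul_le_mul_left h3 (pow_pos hq _)
    -- Weighted Cauchy-Schwarz: `(√q ^ |η \ ω| b_η) ^ 2` is the product of `q ^ |η \ ω| α_η`,
    -- summable by (1), and `b_η ^ 2 / α_η`.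
    have h4 := Finset.sum_sq_le_sum_mul_sum_of_sq_le_mul (D.filter (ω ⊆ ·))
      (r := fun η => √q ^ (η \ ω).card * b η) (f := fun η => q ^ (η \ ω).card * α η)
      (g := fun η => b η ^ 2 / α η)
      (fun η hη => (mul_pos (pow_pos hq _) (hα η (Finset.mem_filter.1 hη).1)).le)
      (fun η hη => div_nonneg (sq_nonneg _) (hα η (Finset.mem_filter.1 hη).1).le)
      (fun η hη => by
        have := (hα η (Finset.mem_filter.1 hη).1).ne'
        refine le_of_eq ?_
        rw [mul_pow, ← pow_mul, mul_comm (η \ ω).card, pow_mul, Real.sq_sqrt hq.le]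
        field_simp)
    refine (pow_le_pow_left₀ (ha ω hω) (hab ω hω) 2).trans (h4.trans ?_)
    refine mul_le_mul_of_nonneg_right hf (Finset.sum_nonneg fun η hη => ?_)
    exact div_nonneg (sq_nonneg _) (hα η (Finset.mem_filter.1 hη).1).le
  calc ∑ ω ∈ D, (γ ω)⁻¹ * a ω ^ 2
      ≤ ∑ ω ∈ D, (γ ω)⁻¹ * (C' * α ω * ∑ η ∈ D with ω ⊆ η, b η ^ 2 / α η) :=
        Finset.sum_le_sum fun ω hω => mul_le_mul_of_nonneg_left (h1 ω hω) (inv_pos.2 (hγ ω hω)).le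
    _ = ∑ ω ∈ D, ∑ η ∈ D, if ω ⊆ η then C' * (α ω / γ ω * (b η ^ 2 / α η)) else 0 := by
        refine Finset.sum_congr rfl fun ω _ => ?_
        rw [← Finset.sum_filter, Finset.mul_sum, Finset.mul_sum]
        exact Finset.sum_congr rfl fun η _ => by rw [div_eq_mul_inv (α ω)]; ring
    _ = ∑ η ∈ D, C' * (b η ^ 2 / α η) * ∑ ω ∈ D with ω ⊆ η, α ω / γ ω := by
        rw [Finset.sum_comm]
        refine Finset.sum_congr rfl fun η _ => ?_
        rw [← Finset.sum_filter, Finset.mul_sum]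
        exact Finset.sum_congr rfl fun ω _ => by ring
    _ ≤ ∑ η ∈ D, C' * (b η ^ 2 / α η) * (C'' * (α η / γ η)) :=
        Finset.sum_le_sum fun η hη => mul_le_mul_of_nonneg_left (hsub η hη)
          (mul_nonneg hC' (div_nonneg (sq_nonneg _) (hα η hη).le))
    _ = C' * C'' * ∑ ω ∈ D, (γ ω)⁻¹ * b ω ^ 2 := by
        rw [Finset.mul_sum]
        refine Finset.sum_congr rfl fun η hη => ?_
        have := (hα η hη).ne'
        have := (hγ η hη).ne'
        field_simp

theorem SupersetCond.sum_le {γ α : Finset ℕ → ℝ} {q C' : ℝ} (h : SupersetCond γ α q C')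
    (hq : 0 < q) (hα : ∀ ω ∈ weightSupport γ, 0 < α ω) {D : Finset (Finset ℕ)}
    (hD : ∀ η ∈ D, η ∈ weightSupport γ) {ω : Finset ℕ} (hω : ω ∈ D) :
    ∑ η ∈ D with ω ⊆ η, q ^ η.card * α η ≤ C' * (q ^ ω.card * α ω) := by
  classical
  obtain ⟨h1, h2⟩ := h ω (hD ω hω)
  refine le_trans ?_ h2
  have h3 := h1.sum_le_tsum
    ((D.filter (ω ⊆ ·)).subtype (fun η => η ∈ weightSupport γ ∧ ω ⊆ η))
    (fun η _ => (mul_pos (pow_pos hq _) (hα η.1 η.2.1)).le)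
  refine le_trans (le_of_eq ?_) h3
  rw [Finset.sum_subtype_of_mem (fun η => q ^ η.card * α η)]
  intro η hη
  exact ⟨hD η (Finset.mem_filter.1 hη).1, (Finset.mem_filter.1 hη).2⟩

theorem SubsetCond.sum_le {γ α : Finset ℕ → ℝ} {C'' : ℝ} (h : SubsetCond γ α C'')
    (hα : ∀ ω ∈ weightSupport γ, 0 < α ω) {D : Finset (Finset ℕ)}
    (hD : ∀ η ∈ D, η ∈ weightSupport γ) {η : Finset ℕ} (hη : η ∈ D) :
    ∑ ω ∈ D with ω ⊆ η, α ω / γ ω ≤ C'' * (α η / γ η) := by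
  refine le_trans (Finset.sum_le_sum_of_subset_of_nonneg (fun ω hω => ?_) fun ω hω _ => ?_)
    (h η (hD η hη))
  · rw [Finset.mem_filter] at hω
    exact Finset.mem_filter.2 ⟨Finset.mem_powerset.2 hω.2, hD ω hω.1⟩
  · have hω' := (Finset.mem_filter.1 hω).2
    exact (div_pos (hα ω hω') hω').le

section Norm

variable {Q R : Set ℕ → ((ℕ → unitInterval) → ℝ) → (ℕ → unitInterval) → ℝ} {γ : Finset ℕ → ℝ}
  {f : (ℕ → unitInterval) → ℝ} {D : Finset (Finset ℕ)}

/-- The weight is moved inside the square, as `√(1 / γ_ω)`, to give an `ℓ²` norm to which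
Minkowski's inequality applies. -/
theorem decompNorm_eq_sum (hD : ∀ η ∈ D, η ∈ weightSupport γ)
    (h0 : ∀ ω ∉ D, decompTerm Q ω f = 0) :
    decompNorm Q γ f = (∑ ω ∈ D, (ENNReal.ofReal √(γ ω)⁻¹
      * mixedDerivNorm (toCube ω (decompTerm Q ω f))) ^ (2 : ℝ)) ^ (1 / 2 : ℝ) := by
  rw [decompNorm, tsum_subtype (weightSupport γ) (fun ω => ENNReal.ofReal (γ ω)⁻¹
    * mixedDerivNorm (toCube ω (decompTerm Q ω f)) ^ 2), tsum_eq_sum (s := D)]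
  · congr 1
    refine Finset.sum_congr rfl fun ω hω => ?_
    have h1 : 0 ≤ (γ ω)⁻¹ := (inv_pos.2 (hD ω hω)).le
    rw [Set.indicator_of_mem (hD ω hω), ENNReal.mul_rpow_of_nonneg _ _ zero_le_two,
      ENNReal.rpow_two, ENNReal.rpow_two, ← ENNReal.ofReal_pow (Real.sqrt_nonneg _),
      Real.sq_sqrt h1]
  · intro ω hω
    rw [Set.indicator_apply_eq_zero]
    intro _
    have h1 : toCube ω (0 : (ℕ → unitInterval) → ℝ) = 0 := rfl
    rw [h0 ω hω, h1, mixedDerivNorm_zero]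
    simp

theorem decompNorm_eq_ofReal (hD : ∀ η ∈ D, η ∈ weightSupport γ)
    (h0 : ∀ ω ∉ D, decompTerm Q ω f = 0)
    (hfin : ∀ ω, mixedDerivNorm (toCube ω (decompTerm Q ω f)) < ⊤) :
    decompNorm Q γ f = ENNReal.ofReal √(∑ ω ∈ D, (γ ω)⁻¹
      * (mixedDerivNorm (toCube ω (decompTerm Q ω f))).toReal ^ 2) := by
  have h1 : ∀ ω ∈ D, 0 ≤ (γ ω)⁻¹ := fun ω hω => (inv_pos.2 (hD ω hω)).le
  rw [decompNorm_eq_sum hD h0, Real.sqrt_eq_rpow, ← ENNReal.ofReal_rpow_of_nonneg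
    (Finset.sum_nonneg fun ω hω => mul_nonneg (h1 ω hω) (sq_nonneg _)) (by norm_num),
    ENNReal.ofReal_sum_of_nonneg fun ω hω => mul_nonneg (h1 ω hω) (sq_nonneg _)]
  congr 1
  refine Finset.sum_congr rfl fun ω hω => ?_
  rw [ENNReal.ofReal_mul (h1 ω hω), ENNReal.ofReal_pow ENNReal.toReal_nonneg,
    ENNReal.ofReal_toReal (hfin ω).ne, ENNReal.mul_rpow_of_nonneg _ _ zero_le_two,
    ENNReal.rpow_two, ENNReal.rpow_two, ← ENNReal.ofReal_pow (Real.sqrt_nonneg _),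
    Real.sq_sqrt (h1 ω hω)]

/-- Transfers finiteness from one decomposition to the other, so it need be proved directly only for
ANOVA terms. -/
theorem mixedDerivNorm_lt_top_of_termBound (hγ : IsMonotoneWeight γ) (hQ : IsProjectorFamily Q)
    (hR : IsProjectorFamily R) {q : ℝ} (hQR : TermBound Q R q) (hf : f ∈ finiteSums γ)
    (hfin : ∀ ω, mixedDerivNorm (toCube ω (decompTerm R ω f)) < ⊤) (ω : Finset ℕ) :
    mixedDerivNorm (toCube ω (decompTerm Q ω f)) < ⊤ := by
  obtain ⟨D, -, hDQ⟩ := exists_support_of_mem_finiteSums hγ hf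
  refine (mixedDerivNorm_decompTerm_le hQ hR hQR (continuous_of_mem_finiteSums hf)
    (hDQ R hR).2 ω).trans_lt (ENNReal.sum_lt_top.2 fun η _ => ?_)
  exact ENNReal.mul_lt_top ENNReal.ofReal_lt_top (hfin η)

theorem decompNorm_le_mul (hγ : IsMonotoneWeight γ) (hQ : IsProjectorFamily Q)
    (hR : IsProjectorFamily R) {q : ℝ} (hq : 0 < q) (hQR : TermBound Q R q)
    (hf : f ∈ finiteSums γ)
    (hfin : ∀ ω, mixedDerivNorm (toCube ω (decompTerm R ω f)) < ⊤) {α : Finset ℕ → ℝ}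
    {C' C'' : ℝ} (hC' : 0 < C') (hC'' : 0 < C'') (hα : ∀ ω ∈ weightSupport γ, 0 < α ω)
    (hsup : SupersetCond γ α q C') (hsub : SubsetCond γ α C'') :
    decompNorm Q γ f ≤ ENNReal.ofReal √(C' * C'') * decompNorm R γ f := by
  obtain ⟨D, hD, hDQ⟩ := exists_support_of_mem_finiteSums hγ hf
  have hfinQ := mixedDerivNorm_lt_top_of_termBound hγ hQ hR hQR hf hfin
  rw [decompNorm_eq_ofReal hD (hDQ Q hQ).1 hfinQ, decompNorm_eq_ofReal hD (hDQ R hR).1 hfin,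
    ← ENNReal.ofReal_mul (Real.sqrt_nonneg _), ← Real.sqrt_mul (mul_pos hC' hC'').le]
  refine ENNReal.ofReal_le_ofReal (Real.sqrt_le_sqrt ?_)
  refine sum_inv_mul_sq_le hq hC'.le hD (fun ω hω => hα ω (hD ω hω))
    (fun _ _ => ENNReal.toReal_nonneg) (fun ω hω => hsup.sum_le hq hα hD hω)
    (fun η hη => hsub.sum_le hα hD hη) fun ω _ => ?_
  have h1 := mixedDerivNorm_decompTerm_le hQ hR hQR (continuous_of_mem_finiteSums hf)
    (hDQ R hR).2 ω
  have h2 : ∀ η ∈ D.filter (ω ⊆ ·), ENNReal.ofReal (√q ^ (η \ ω).card)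
      * mixedDerivNorm (toCube η (decompTerm R η f)) ≠ ⊤ := fun η _ =>
    (ENNReal.mul_lt_top ENNReal.ofReal_lt_top (hfin η)).ne
  have h3 := ENNReal.toReal_mono (ENNReal.sum_ne_top.2 h2) h1
  rw [ENNReal.toReal_sum h2] at h3
  refine h3.trans (le_of_eq (Finset.sum_congr rfl fun η _ => ?_))
  rw [ENNReal.toReal_mul, ENNReal.toReal_ofReal (by positivity)]

theorem decompNorm_lt_top (hγ : IsMonotoneWeight γ) (hQ : IsProjectorFamily Q)
    (hf : f ∈ finiteSums γ)
    (hfin : ∀ ω, mixedDerivNorm (toCube ω (decompTerm Q ω f)) < ⊤) : decompNorm Q γ f < ⊤ := by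
  obtain ⟨D, hD, hDQ⟩ := exists_support_of_mem_finiteSums hγ hf
  rw [decompNorm_eq_ofReal hD (hDQ Q hQ).1 hfin]
  exact ENNReal.ofReal_lt_top

theorem decompNorm_le_add_sub (hγ : IsMonotoneWeight γ) (hQ : IsProjectorFamily Q)
    {g : (ℕ → unitInterval) → ℝ} (hf : f ∈ finiteSums γ) (hg : g ∈ finiteSums γ) :
    decompNorm Q γ f ≤ decompNorm Q γ g + decompNorm Q γ (f - g) := by
  classical
  have hfg := sub_mem_finiteSums hf hg
  have hgc := continuous_of_mem_finiteSums hg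
  have hfgc := continuous_of_mem_finiteSums hfg
  obtain ⟨D₁, hD₁, hQ₁⟩ := exists_support_of_mem_finiteSums hγ hg
  obtain ⟨D₂, hD₂, hQ₂⟩ := exists_support_of_mem_finiteSums hγ hfg
  have hD : ∀ η ∈ D₁ ∪ D₂, η ∈ weightSupport γ := fun η hη =>
    (Finset.mem_union.1 hη).elim (hD₁ η) (hD₂ η)
  have h1 : ∀ ω ∉ D₁ ∪ D₂, decompTerm Q ω g = 0 := fun ω hω =>
    (hQ₁ Q hQ).1 ω fun h => hω (Finset.mem_union_left _ h)
  have h2 : ∀ ω ∉ D₁ ∪ D₂, decompTerm Q ω (f - g) = 0 := fun ω hω =>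
    (hQ₂ Q hQ).1 ω fun h => hω (Finset.mem_union_right _ h)
  have h3 : ∀ ω, decompTerm Q ω f = decompTerm Q ω g + decompTerm Q ω (f - g) := fun ω => by
    rw [← hQ.decompTerm_add ω hgc hfgc, add_sub_cancel]
  rw [decompNorm_eq_sum hD h1, decompNorm_eq_sum hD h2,
    decompNorm_eq_sum hD fun ω hω => by rw [h3, h1 ω hω, h2 ω hω, add_zero]]
  refine le_trans ?_ (ENNReal.Lp_add_le _ _ _ one_le_two)
  refine ENNReal.rpow_le_rpow (Finset.sum_le_sum fun ω _ => ?_) (by norm_num)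
  refine ENNReal.rpow_le_rpow ?_ zero_le_two
  rw [← mul_add, h3]
  gcongr
  exact mixedDerivNorm_add_le (continuous_toCube ω (hQ.continuous_decompTerm ω hgc))
    (continuous_toCube ω (hQ.continuous_decompTerm ω hfgc))

end Norm

/-! ## Cauchy sequences -/

theorem IsCauchyFor.of_le_mul {N M : ((ℕ → unitInterval) → ℝ) → ℝ≥0∞}
    {u : ℕ → (ℕ → unitInterval) → ℝ} {c : ℝ≥0∞} (hc : c ≠ ⊤)
    (h : ∀ m n, M (u m - u n) ≤ c * N (u m - u n)) (hN : IsCauchyFor N u) : IsCauchyFor M u := by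
  intro ε hε
  obtain ⟨n₀, h₀⟩ := hN (ε / c) (ENNReal.div_pos hε.ne' hc)
  refine ⟨n₀, fun m hm n hn => (h m n).trans_lt ?_⟩
  exact ENNReal.mul_lt_of_lt_div' (h₀ m hm n hn)

theorem IsCauchyFor.exists_tendsto {N : ((ℕ → unitInterval) → ℝ) → ℝ≥0∞}
    {u : ℕ → (ℕ → unitInterval) → ℝ} (hN : IsCauchyFor N u) (hfin : ∀ n, N (u n) < ⊤)
    (hadd : ∀ m n, N (u m) ≤ N (u n) + N (u m - u n)) :
    ∃ a < ⊤, Tendsto (fun n => N (u n)) atTop (𝓝 a) := by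
  have hC : CauchySeq fun n => (N (u n)).toReal := by
    refine Metric.cauchySeq_iff.2 fun ε hε => ?_
    obtain ⟨n₀, h₀⟩ := hN (ENNReal.ofReal ε) (ENNReal.ofReal_pos.2 hε)
    have key : ∀ m ≥ n₀, ∀ n ≥ n₀, (N (u m)).toReal < (N (u n)).toReal + ε := fun m hm n hn => by
      have h1 : N (u m) < N (u n) + ENNReal.ofReal ε :=
        (hadd m n).trans_lt (ENNReal.add_lt_add_left (hfin n).ne (h₀ m hm n hn))
      have h2 := (ENNReal.toReal_lt_toReal (hfin m).ne
        (ENNReal.add_lt_top.2 ⟨hfin n, ENNReal.ofReal_lt_top⟩).ne).2 h1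
      rwa [ENNReal.toReal_add (hfin n).ne ENNReal.ofReal_ne_top,
        ENNReal.toReal_ofReal hε.le] at h2
    refine ⟨n₀, fun m hm n hn => ?_⟩
    rw [Real.dist_eq, abs_lt]
    constructor <;> linarith [key m hm n hn, key n hn m hm]
  obtain ⟨a, ha⟩ := cauchySeq_tendsto_of_complete hC
  refine ⟨ENNReal.ofReal a, ENNReal.ofReal_lt_top, ?_⟩
  refine (ENNReal.tendsto_ofReal ha).congr fun n => ENNReal.ofReal_toReal (hfin n).ne

/-! ## The product weights -/

/-- Since `2 x ≤ 1`, the powers of `2 x` decrease. With `x = t / 3` this is where `t ≤ 3/2` enters.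
-/
theorem superset_pow_le {x : ℝ} (hx0 : 0 ≤ x) (hx : x ≤ 2⁻¹) {s : ℝ} (hs : 0 ≤ s) {m n : ℕ}
    (hmn : m ≤ n) :
    x ^ n * s ≤ (2 * x) ^ m * ((2 ^ n : ℝ)⁻¹ * s) := by
  have h1 : x ^ n = (2 * x) ^ n * (2 ^ n : ℝ)⁻¹ := by
    rw [mul_pow]; field_simp
  rw [h1, mul_assoc]
  refine mul_le_mul_of_nonneg_right ?_ (by positivity)
  exact pow_le_pow_of_le_one (by positivity) (by linarith) hmn

theorem EarlierCond.supersetCond {γ : Finset ℕ → ℝ} {C' C'' : ℝ} (h : EarlierCond γ C' C'')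
    {t : ℝ} (ht1 : 1 ≤ t) (ht : t ≤ 3 / 2) :
    SupersetCond γ (fun ω => t ^ ω.card * √(γ ω)) (1 / 3) C' := by
  intro ω hω
  obtain ⟨⟨h1, h2⟩, -⟩ := h ω hω
  have hx0 : 0 ≤ 1 / 3 * t := by positivity
  have hx : 1 / 3 * t ≤ 2⁻¹ := by linarith
  have hle : ∀ η : {η : Finset ℕ // η ∈ weightSupport γ ∧ ω ⊆ η},
      (1 / 3 : ℝ) ^ η.1.card * (t ^ η.1.card * √(γ η.1))
        ≤ (2 * (1 / 3 * t)) ^ ω.card * ((2 ^ η.1.card : ℝ)⁻¹ * √(γ η.1)) := fun η => by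
    rw [← mul_assoc, ← mul_pow]
    exact superset_pow_le hx0 hx (Real.sqrt_nonneg _) (Finset.card_le_card η.2.2)
  have hs := h1.mul_left ((2 * (1 / 3 * t)) ^ ω.card)
  have hs' := hs.of_nonneg_of_le (fun η => by positivity) hle
  refine ⟨hs', (hs'.tsum_le_tsum hle hs).trans ?_⟩
  rw [tsum_mul_left]
  refine (mul_le_mul_of_nonneg_left h2 (by positivity)).trans (le_of_eq ?_)
  -- `(2 t / 3) ^ |ω| * 2 ^ (-|ω|) = (t / 3) ^ |ω|`, so the constant `C'` is unchanged.
  rw [mul_pow, mul_pow]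
  field_simp

/-- `√γ / γ = 1 / √γ`, and `t ≥ 1` lets `t ^ |η|` be replaced by `t ^ |ω|` for `η ⊆ ω`. -/
theorem EarlierCond.subsetCond {γ : Finset ℕ → ℝ} {C' C'' : ℝ} (h : EarlierCond γ C' C'')
    {t : ℝ} (ht1 : 1 ≤ t) : SubsetCond γ (fun ω => t ^ ω.card * √(γ ω)) C'' := by
  intro ω hω
  obtain ⟨-, h1⟩ := h ω hω
  have h2 : ∀ η : Finset ℕ, t ^ η.card * √(γ η) / γ η = t ^ η.card * (1 / √(γ η)) := fun η => by
    rw [mul_div_assoc, Real.sqrt_div_self']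
  simp only [h2]
  calc ∑ η ∈ ω.powerset with 0 < γ η, t ^ η.card * (1 / √(γ η))
      ≤ ∑ η ∈ ω.powerset with 0 < γ η, t ^ ω.card * (1 / √(γ η)) := by
        refine Finset.sum_le_sum fun η hη => mul_le_mul_of_nonneg_right ?_ (by positivity)
        exact pow_le_pow_right₀ ht1
          (Finset.card_le_card (Finset.mem_powerset.1 (Finset.mem_filter.1 hη).1))
    _ ≤ t ^ ω.card * (C'' / √(γ ω)) := by
        rw [← Finset.mul_sum]
        exact mul_le_mul_of_nonneg_left h1 (by positivity)
    _ = C'' * (t ^ ω.card * (1 / √(γ ω))) := by ring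

end AnovaAnchored

/-! ### The norm equivalence and the earlier condition -/

open AnovaAnchored in
theorem proposition5 (γ : Finset ℕ → ℝ) (hγ : IsMonotoneWeight γ) :
    -- the norm equivalence, on finite sums and on the completions
    (∀ (xs : unitInterval) (α : Finset ℕ → ℝ) (C' C'' : ℝ), 0 < C' → 0 < C'' →
      (∀ ω ∈ weightSupport γ, 0 < α ω) →
      SupersetCond γ α (anchorConst xs) C' →
      SubsetCond γ α C'' →
      (∀ f ∈ finiteSums γ,
        anovaNorm γ f < ⊤ ∧ anchoredNorm xs γ f < ⊤ ∧
        ENNReal.ofReal (√(C' * C''))⁻¹ * anchoredNorm xs γ f ≤ anovaNorm γ f ∧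
        anovaNorm γ f ≤ ENNReal.ofReal (√(C' * C'')) * anchoredNorm xs γ f) ∧
      (∀ u : ℕ → (ℕ → unitInterval) → ℝ, (∀ n, u n ∈ finiteSums γ) →
        (IsCauchyFor (anovaNorm γ) u ↔ IsCauchyFor (anchoredNorm xs γ) u) ∧
        (IsCauchyFor (anovaNorm γ) u →
          ∃ a b : ENNReal, a < ⊤ ∧ b < ⊤ ∧
            Tendsto (fun n => anovaNorm γ (u n)) atTop (𝓝 a) ∧
            Tendsto (fun n => anchoredNorm xs γ (u n)) atTop (𝓝 b) ∧
            ENNReal.ofReal (√(C' * C''))⁻¹ * b ≤ a ∧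
            a ≤ ENNReal.ofReal (√(C' * C'')) * b))) ∧
    -- the earlier condition for the anchor `0`, where `q = 1/3`, implies the two conditions
    (∀ C' C'' : ℝ, 0 < C' → 0 < C'' → EarlierCond γ C' C'' →
      ∀ qt : ℝ, 1 ≤ qt → qt ≤ 3 / 2 →
        SupersetCond γ (fun ω => qt ^ ω.card * √(γ ω)) (1 / 3) C' ∧
        SubsetCond γ (fun ω => qt ^ ω.card * √(γ ω)) C'') := by
  refine ⟨fun xs α C' C'' hC' hC'' hα hsup hsub => ?_, fun C' C'' _ _ h t ht1 ht =>
    ⟨h.supersetCond ht1 ht, h.subsetCond ht1⟩⟩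
  have hA := isProjectorFamily_avg
  have hP := isProjectorFamily_anchorAt xs
  have hq := anchorConst_pos xs
  have hcpos : 0 < √(C' * C'') := Real.sqrt_pos.2 (mul_pos hC' hC'')
  have finA : ∀ f ∈ finiteSums γ, ∀ ω, mixedDerivNorm (toCube ω (decompTerm avg ω f)) < ⊤ :=
    fun f hf => mixedDerivNorm_avg_lt_top hf
  have finP : ∀ f ∈ finiteSums γ, ∀ ω,
      mixedDerivNorm (toCube ω (decompTerm (anchorAt xs) ω f)) < ⊤ := fun f hf =>
    mixedDerivNorm_lt_top_of_termBound hγ hP hA (termBound_anchorAt_avg xs) hf (finA f hf)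
  have hAP : ∀ f ∈ finiteSums γ,
      anovaNorm γ f ≤ ENNReal.ofReal √(C' * C'') * anchoredNorm xs γ f := fun f hf =>
    decompNorm_le_mul hγ hA hP hq (termBound_avg_anchorAt xs) hf (finP f hf) hC' hC'' hα hsup hsub
  have hPA : ∀ f ∈ finiteSums γ,
      anchoredNorm xs γ f ≤ ENNReal.ofReal √(C' * C'') * anovaNorm γ f := fun f hf =>
    decompNorm_le_mul hγ hP hA hq (termBound_anchorAt_avg xs) hf (finA f hf) hC' hC'' hα hsup hsub
  have hPA' : ∀ f ∈ finiteSums γ,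
      ENNReal.ofReal (√(C' * C''))⁻¹ * anchoredNorm xs γ f ≤ anovaNorm γ f := fun f hf => by
    refine (mul_le_mul_right (hPA f hf) _).trans (le_of_eq ?_)
    rw [← mul_assoc, ← ENNReal.ofReal_mul (inv_pos.2 hcpos).le, inv_mul_cancel₀ hcpos.ne',
      ENNReal.ofReal_one, one_mul]
  have ltA : ∀ f ∈ finiteSums γ, anovaNorm γ f < ⊤ := fun f hf =>
    decompNorm_lt_top hγ hA hf (finA f hf)
  have ltP : ∀ f ∈ finiteSums γ, anchoredNorm xs γ f < ⊤ := fun f hf =>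
    decompNorm_lt_top hγ hP hf (finP f hf)
  refine ⟨fun f hf => ⟨ltA f hf, ltP f hf, hPA' f hf, hAP f hf⟩, fun u hu => ?_⟩
  have hsubm : ∀ m n, u m - u n ∈ finiteSums γ := fun m n => sub_mem_finiteSums (hu m) (hu n)
  have hiff : IsCauchyFor (anovaNorm γ) u ↔ IsCauchyFor (anchoredNorm xs γ) u :=
    ⟨fun h => h.of_le_mul ENNReal.ofReal_ne_top fun m n => hPA _ (hsubm m n),
      fun h => h.of_le_mul ENNReal.ofReal_ne_top fun m n => hAP _ (hsubm m n)⟩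
  refine ⟨hiff, fun h => ?_⟩
  obtain ⟨a, ha, hat⟩ := h.exists_tendsto (fun n => ltA _ (hu n))
    fun m n => decompNorm_le_add_sub hγ hA (hu m) (hu n)
  obtain ⟨b, hb, hbt⟩ := (hiff.1 h).exists_tendsto (fun n => ltP _ (hu n))
    fun m n => decompNorm_le_add_sub hγ hP (hu m) (hu n)
  refine ⟨a, b, ha, hb, hat, hbt, ?_, ?_⟩
  · exact le_of_tendsto_of_tendsto' (ENNReal.Tendsto.const_mul hbt (Or.inr ENNReal.ofReal_ne_top))
      hat fun n => hPA' _ (hu n)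
  · exact le_of_tendsto_of_tendsto' hat
      (ENNReal.Tendsto.const_mul hbt (Or.inr ENNReal.ofReal_ne_top)) fun n => hAP _ (hu n)
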